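/- Let $G$ be a discrete group and let $A$ be a $C^*$-algebra. Write $C^*(G)$ for the full group $C^*$-algebra of $G$, identify $s\in G$ with its canonical image in $C^*(G)$, and let $\otimes$ denote the maximal $C^*$-tensor product (this is the only $C^*$-tensor product when one of the factors is nuclear). Let $\delta_G:C^*(G)\to C^*(G)\otimes C^*(G)$ be the comultiplication $s\mapsto s\otimes s$. A coaction of $G$ on $A$ is an injective $*$-homomorphism $\delta:A\to A\otimes C^*(G)$ which is nondegenerate, i.e. $\operatorname{span}\,\delta(A)(A\otimes C^*(G))$ is dense in $A\otimes C^*(G)$, and satisfies $(\delta\otimes\operatorname{id})\circ\delta=(\operatorname{id}\otimes\delta_G)\circ\delta$. For $s\in G$ put $A_s=\{a\in A:\delta(a)=a\otimes s\}$; the fixed point algebra of $\delta$ is $A^\delta=A_{1}$, where $1$ is the identity of $G$. Let $\chi_t\in C_0(G)$ be the characteristic function of $\{t\}$. A covariant representation of $(A,G,\delta)$ is a pair $(\pi,\mu)$ of nondegenerate representations of $A$ and $C_0(G)$ on a Hilbert space such that $\pi(a)\mu(\chi_t)=\mu(\chi_{st})\pi(a)$ for all $s,t\in G$ and $a\in A_s$.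 The crossed product $A\times_\delta G$ is the $C^*$-algebra generated by the products $j_A(a)j_G(f)$, $a\in A$, $f\in C_0(G)$, where $(j_A,j_G)$ is the universal covariant representation, i.e. the direct sum of all covariant representations. Let $\delta$ be a coaction of $G$ on $A$. Then the set $j_G(\chi_1)(A\times_\delta G)j_G(\chi_1)$ is a $*$-subalgebra of $A\times_\delta G$ (a corner), and the fixed point algebra $A^\delta$ is $*$-isomorphic to it. -/

import Mathlib

open scoped TensorProduct ENNReal ZeroAtInfty

noncomputable section

namespace DiscreteCoaction

universe u v w

/-! ### C*-seminorms and the associated Hausdorff completions -/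

/-- A C*-seminorm on a complex (not necessarily unital) *-algebra. -/
structure CStarSeminorm (R : Type u) [NonUnitalRing R] [StarRing R] [Module ℂ R] where
  toSeminorm : Seminorm ℂ R
  mul_le : ∀ x y, toSeminorm (x * y) ≤ toSeminorm x * toSeminorm y
  star_mul_self : ∀ x, toSeminorm (star x * x) = toSeminorm x * toSeminorm x

namespace CStarSeminorm

section Basic

variable {R : Type u} [NonUnitalRing R] [StarRing R] [Module ℂ R]

instance : CoeFun (CStarSeminorm R) (fun _ => R → ℝ) := ⟨fun p => p.toSeminorm⟩

theorem nonneg (p : CStarSeminorm R) (x : R) : 0 ≤ p x := apply_nonneg p.toSeminorm x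

theorem le_star (p : CStarSeminorm R) (x : R) : p x ≤ p (star x) := by
  rcases (p.nonneg x).eq_or_lt with h | h
  · rw [← h]; exact p.nonneg _
  · have h1 := p.star_mul_self x
    have h2 := p.mul_le (star x) x
    rw [h1] at h2
    exact le_of_mul_le_mul_right h2 h

theorem map_star (p : CStarSeminorm R) (x : R) : p (star x) = p x :=
  le_antisymm (by simpa using p.le_star (star x)) (p.le_star x)

/-- The zero C*-seminorm. -/
def zero : CStarSeminorm R where
  toSeminorm := 0
  mul_le _ _ := by simp
  star_mul_self _ := by simp

/-- The pullback of the norm of a C*-algebra along a *-homomorphism. -/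
def comap {D : Type v} [NonUnitalCStarAlgebra D] (f : R →⋆ₙₐ[ℂ] D) : CStarSeminorm R where
  toSeminorm := Seminorm.of (fun x => ‖f x‖)
    (fun x y => by rw [map_add]; exact norm_add_le _ _)
    (fun c x => by rw [map_smul, norm_smul])
  mul_le x y := by
    change ‖f (x * y)‖ ≤ ‖f x‖ * ‖f y‖
    rw [map_mul]; exact norm_mul_le _ _
  star_mul_self x := by
    change ‖f (star x * x)‖ = ‖f x‖ * ‖f x‖
    rw [map_mul, StarHomClass.map_star, CStarRing.norm_star_mul_self]

/-- The pointwise supremum of a nonempty, pointwise bounded set of C*-seminorms. -/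
def sup (S : Set (CStarSeminorm R)) (hS : S.Nonempty)
    (hb : ∀ x, ∃ C : ℝ, ∀ p ∈ S, p x ≤ C) : CStarSeminorm R :=
  have : Nonempty S := hS.to_subtype
  have bdd : ∀ x, BddAbove (Set.range fun p : S => p.1 x) := fun x => by
    obtain ⟨C, hC⟩ := hb x
    exact ⟨C, by rintro _ ⟨p, rfl⟩; exact hC p.1 p.2⟩
  have nn : ∀ x, 0 ≤ ⨆ p : S, p.1 x := fun x => Real.iSup_nonneg fun p => p.1.nonneg x
  { toSeminorm := Seminorm.of (fun x => ⨆ p : S, p.1 x)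
      (fun x y => ciSup_le fun p => (map_add_le_add p.1.toSeminorm x y).trans
        (add_le_add (le_ciSup (bdd x) p) (le_ciSup (bdd y) p)))
      (fun c x => by
        rw [Real.mul_iSup_of_nonneg (norm_nonneg c)]
        exact iSup_congr fun p => map_smul_eq_mul p.1.toSeminorm c x)
    mul_le := fun x y => ciSup_le fun p => (p.1.mul_le x y).trans
      (mul_le_mul (le_ciSup (bdd x) p) (le_ciSup (bdd y) p) (p.1.nonneg y) (nn x))
    star_mul_self := fun x => by
      change (⨆ p : S, p.1 (star x * x)) = (⨆ p : S, p.1 x) * ⨆ p : S, p.1 x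
      apply le_antisymm
      · refine ciSup_le fun p => ?_
        rw [p.1.star_mul_self]
        exact mul_le_mul (le_ciSup (bdd x) p) (le_ciSup (bdd x) p) (p.1.nonneg x) (nn x)
      · have h0 := nn (star x * x)
        have : (⨆ p : S, p.1 x) ≤ √(⨆ p : S, p.1 (star x * x)) := by
          refine ciSup_le fun p => Real.le_sqrt_of_sq_le ?_
          rw [sq, ← p.1.star_mul_self]
          exact le_ciSup (bdd (star x * x)) p
        calc _ ≤ √(⨆ p : S, p.1 (star x * x)) * √(⨆ p : S, p.1 (star x * x)) :=
              mul_le_mul this this (nn x) (Real.sqrt_nonneg _)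
          _ = _ := Real.mul_self_sqrt h0 }

theorem le_sup {S : Set (CStarSeminorm R)} (hS : S.Nonempty)
    (hb : ∀ x, ∃ C : ℝ, ∀ p ∈ S, p x ≤ C) {p : CStarSeminorm R} (hp : p ∈ S) (x : R) :
    p x ≤ sup S hS hb x := by
  obtain ⟨C, hC⟩ := hb x
  exact le_ciSup (f := fun p : S => p.1 x)
    ⟨C, by rintro _ ⟨p, rfl⟩; exact hC p.1 p.2⟩ ⟨p, hp⟩

theorem sup_le {S : Set (CStarSeminorm R)} (hS : S.Nonempty)
    (hb : ∀ x, ∃ C : ℝ, ∀ p ∈ S, p x ≤ C) {x : R} {c : ℝ} (h : ∀ p ∈ S, p x ≤ c) :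
    sup S hS hb x ≤ c :=
  have : Nonempty S := hS.to_subtype
  ciSup_le fun p : S => h p.1 p.2

end Basic

section Completion

variable {R : Type u} [NonUnitalRing R] [StarRing R] [Module ℂ R]

/-- The *-algebra `R`, regarded as a seminormed *-algebra through `N`. -/
def Pre (_N : CStarSeminorm R) : Type u := R

variable (N : CStarSeminorm R)

instance : NonUnitalSeminormedRing N.Pre :=
  { N.toSeminorm.toAddGroupSeminorm.toSeminormedAddCommGroup, (inferInstance : NonUnitalRing R) with
    norm_mul_le := N.mul_le }

theorem pre_norm (x : N.Pre) : ‖x‖ = N x := rfl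

instance : StarRing N.Pre := inferInstanceAs (StarRing R)

instance : NormedSpace ℂ N.Pre :=
  { (inferInstance : Module ℂ R) with
    norm_smul_le := fun c x => (map_smul_eq_mul N.toSeminorm c x).le }

instance : NormedStarGroup N.Pre where
  norm_star_le x := (N.map_star x).le

/-- The Hausdorff completion of `R` in the C*-seminorm `N`. -/
def Compl : Type u := UniformSpace.Completion N.Pre

instance : NormedAddCommGroup N.Compl :=
  inferInstanceAs (NormedAddCommGroup (UniformSpace.Completion N.Pre))
instance : NormedSpace ℂ N.Compl :=
  inferInstanceAs (NormedSpace ℂ (UniformSpace.Completion N.Pre))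
instance : CompleteSpace N.Compl :=
  inferInstanceAs (CompleteSpace (UniformSpace.Completion N.Pre))

/-- The canonical map from `R` to its completion. -/
def toCompl : R →ₗ[ℂ] N.Compl where
  toFun x := ((show N.Pre from x : N.Pre) : UniformSpace.Completion N.Pre)
  map_add' x y := UniformSpace.Completion.coe_add (α := N.Pre) x y
  map_smul' c x := UniformSpace.Completion.coe_smul (X := N.Pre) c x

theorem norm_toCompl (x : R) : ‖N.toCompl x‖ = N x :=
  UniformSpace.Completion.norm_coe (E := N.Pre) x

theorem denseRange_toCompl : DenseRange N.toCompl :=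
  UniformSpace.Completion.denseRange_coe (α := N.Pre)

variable {N} in
@[elab_as_elim]
theorem induction_on {P : N.Compl → Prop} (x : N.Compl) (hc : IsClosed {x | P x})
    (h : ∀ x : R, P (N.toCompl x)) : P x :=
  UniformSpace.Completion.induction_on (α := N.Pre) x hc h

/-- A linear map that is bounded for `N` extends to the completion. -/
def extendL {D : Type v} [NormedAddCommGroup D] [NormedSpace ℂ D] [CompleteSpace D]
    (f : R →ₗ[ℂ] D) (K : ℝ) (hf : ∀ x, ‖f x‖ ≤ K * N x) : N.Compl →L[ℂ] D :=
  (LinearMap.mkContinuous (show N.Pre →ₗ[ℂ] D from f) K hf).extend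
    (UniformSpace.Completion.toComplL : N.Pre →L[ℂ] UniformSpace.Completion N.Pre)

theorem extendL_toCompl {D : Type v} [NormedAddCommGroup D] [NormedSpace ℂ D] [CompleteSpace D]
    (f : R →ₗ[ℂ] D) (K : ℝ) (hf : ∀ x, ‖f x‖ ≤ K * N x) (x : R) :
    N.extendL f K hf (N.toCompl x) = f x :=
  ContinuousLinearMap.extend_eq
    (e := (UniformSpace.Completion.toComplL : N.Pre →L[ℂ] UniformSpace.Completion N.Pre)) _
    (UniformSpace.Completion.denseRange_coe) (UniformSpace.Completion.isUniformInducing_coe _) x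

theorem norm_extendL_le {D : Type v} [NormedAddCommGroup D] [NormedSpace ℂ D] [CompleteSpace D]
    (f : R →ₗ[ℂ] D) (K : ℝ) (hf : ∀ x, ‖f x‖ ≤ K * N x) (x : N.Compl) :
    ‖N.extendL f K hf x‖ ≤ K * ‖x‖ := by
  refine induction_on x (isClosed_le (by fun_prop) (by fun_prop)) fun x => ?_
  rw [extendL_toCompl, norm_toCompl]
  exact hf x

theorem ext_of_toCompl {D : Type v} [NormedAddCommGroup D] [NormedSpace ℂ D]
    {f g : N.Compl →L[ℂ] D} (h : ∀ x, f (N.toCompl x) = g (N.toCompl x)) : f = g :=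
  ContinuousLinearMap.ext fun x =>
    induction_on x (isClosed_eq f.continuous g.continuous) h

instance : Star N.Compl where
  star := UniformSpace.Completion.map (fun x : N.Pre => star x)

theorem uniformContinuous_star_pre : UniformContinuous (fun x : N.Pre => star x) :=
  (AddMonoidHomClass.isometry_of_norm (starAddEquiv : N.Pre ≃+ N.Pre)
    (fun x => norm_star x)).uniformContinuous

theorem toCompl_star (x : R) : N.toCompl (star x) = star (N.toCompl x) :=
  (UniformSpace.Completion.map_coe N.uniformContinuous_star_pre x).symm

instance : ContinuousStar N.Compl where
  continuous_star :=
    UniformSpace.Completion.continuous_map (f := fun x : N.Pre => star x)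

variable [IsScalarTower ℂ R R] [SMulCommClass ℂ R R]

/-- Multiplication on the completion, as a bounded bilinear map. -/
def mulL : N.Compl →L[ℂ] N.Compl →L[ℂ] N.Compl :=
  have h1 : ∀ x y : R, ‖(N.toCompl ∘ₗ LinearMap.mulLeft ℂ x) y‖ ≤ N x * N y := fun x y => by
    change ‖N.toCompl (x * y)‖ ≤ _
    rw [norm_toCompl]
    exact N.mul_le x y
  N.extendL
    { toFun := fun x => N.extendL (N.toCompl ∘ₗ LinearMap.mulLeft ℂ x) (N x) (h1 x)
      map_add' := fun x y => N.ext_of_toCompl fun z => by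
        simp [extendL_toCompl, add_mul]
      map_smul' := fun c x => N.ext_of_toCompl fun z => by
        simp [extendL_toCompl, smul_mul_assoc] }
    1 (fun x => by
      rw [one_mul]
      exact ContinuousLinearMap.opNorm_le_bound _ (N.nonneg x) (N.norm_extendL_le _ _ _))

instance : Mul N.Compl where
  mul x y := N.mulL x y

theorem toCompl_mul (x y : R) : N.toCompl (x * y) = N.toCompl x * N.toCompl y := by
  change _ = N.mulL (N.toCompl x) (N.toCompl y)
  simp [mulL, extendL_toCompl]

instance : ContinuousMul N.Compl where
  continuous_mul := by
    change Continuous fun p : N.Compl × N.Compl => N.mulL p.1 p.2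
    fun_prop

instance : NonUnitalNormedRing N.Compl :=
  { (inferInstance : NormedAddCommGroup N.Compl) with
    mul := fun x y => x * y
    zero_mul := fun x => show N.mulL 0 x = 0 by simp
    mul_zero := fun x => show N.mulL x 0 = 0 by simp
    left_distrib := fun x y z => (N.mulL x).map_add y z
    right_distrib := fun x y z => show N.mulL (x + y) z = N.mulL x z + N.mulL y z by simp
    mul_assoc := fun x y z => by
      change x * y * z = x * (y * z)
      refine induction_on x (isClosed_eq (by fun_prop) (by fun_prop)) fun x => ?_
      refine induction_on y (isClosed_eq (by fun_prop) (by fun_prop)) fun y => ?_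
      refine induction_on z (isClosed_eq (by fun_prop) (by fun_prop)) fun z => ?_
      simp only [← toCompl_mul, mul_assoc]
    norm_mul_le := fun x y => by
      change ‖x * y‖ ≤ ‖x‖ * ‖y‖
      refine induction_on x (isClosed_le (by fun_prop) (by fun_prop)) fun x => ?_
      refine induction_on y (isClosed_le (by fun_prop) (by fun_prop)) fun y => ?_
      rw [← toCompl_mul, norm_toCompl, norm_toCompl, norm_toCompl]
      exact N.mul_le x y }

instance : StarRing N.Compl where
  star_involutive x := by
    refine induction_on x (isClosed_eq (by fun_prop) (by fun_prop)) fun x => ?_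
    simp only [← toCompl_star, star_star]
  star_mul x y := by
    refine induction_on x (isClosed_eq (by fun_prop) (by fun_prop)) fun x => ?_
    refine induction_on y (isClosed_eq (by fun_prop) (by fun_prop)) fun y => ?_
    simp only [← toCompl_star, ← toCompl_mul, star_mul]
  star_add x y := by
    refine induction_on x (isClosed_eq (by fun_prop) (by fun_prop)) fun x => ?_
    refine induction_on y (isClosed_eq (by fun_prop) (by fun_prop)) fun y => ?_
    simp only [← toCompl_star, ← map_add, star_add]

instance : CStarRing N.Compl where
  norm_mul_self_le x := by
    refine induction_on x (isClosed_le (by fun_prop) (by fun_prop)) fun x => ?_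
    rw [← toCompl_star, ← toCompl_mul, norm_toCompl, norm_toCompl, N.star_mul_self]

instance : IsScalarTower ℂ N.Compl N.Compl where
  smul_assoc c x y := show N.mulL (c • x) y = c • N.mulL x y by simp

instance : SMulCommClass ℂ N.Compl N.Compl where
  smul_comm c x y := show c • N.mulL x y = N.mulL x (c • y) by simp

instance [StarModule ℂ R] : StarModule ℂ N.Compl where
  star_smul c x := by
    have h1 : Continuous fun x : N.Compl => star (c • x) :=
      (continuous_const_smul c).star
    have h2 : Continuous fun x : N.Compl => star c • star x :=
      continuous_star.const_smul (star c)
    refine induction_on x (isClosed_eq h1 h2) fun x => ?_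
    rw [← map_smul, ← toCompl_star, ← toCompl_star, star_smul, map_smul]

instance [StarModule ℂ R] : NonUnitalCStarAlgebra N.Compl where

/-- A *-homomorphism into a C*-algebra that is contractive for `N` extends to the completion. -/
def lift {D : Type v} [NonUnitalCStarAlgebra D] (f : R →⋆ₙₐ[ℂ] D) (hf : ∀ x, ‖f x‖ ≤ N x) :
    N.Compl →⋆ₙₐ[ℂ] D where
  __ := (N.extendL (f : R →ₗ[ℂ] D) 1 (by simpa using hf)).toLinearMap
  toFun := N.extendL (f : R →ₗ[ℂ] D) 1 (by simpa using hf)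
  map_zero' := map_zero _
  map_mul' x y := by
    refine induction_on x (isClosed_eq (by fun_prop) (by fun_prop)) fun x => ?_
    refine induction_on y (isClosed_eq (by fun_prop) (by fun_prop)) fun y => ?_
    simp only [← toCompl_mul, extendL_toCompl]
    exact map_mul f x y
  map_star' x := by
    refine induction_on x (isClosed_eq (by fun_prop) (by fun_prop)) fun x => ?_
    simp only [← toCompl_star, extendL_toCompl]
    exact StarHomClass.map_star f x

theorem lift_toCompl {D : Type v} [NonUnitalCStarAlgebra D] (f : R →⋆ₙₐ[ℂ] D)
    (hf : ∀ x, ‖f x‖ ≤ N x) (x : R) : N.lift f hf (N.toCompl x) = f x :=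
  extendL_toCompl N (f : R →ₗ[ℂ] D) 1 (by simpa using hf) x

end Completion

section Unital

variable {R : Type u} [Ring R] [StarRing R] [Algebra ℂ R] [StarModule ℂ R]

instance (N : CStarSeminorm R) : One N.Compl where
  one := N.toCompl 1

/-- The completion of a unital *-algebra is a unital normed ring. -/
@[reducible] def unitalRing (N : CStarSeminorm R) : NormedRing N.Compl :=
  { (inferInstance : NonUnitalNormedRing N.Compl) with
    one := 1
    one_mul := fun x => by
      change (1 : N.Compl) * x = x
      refine induction_on x (isClosed_eq (by fun_prop) (by fun_prop)) fun x => ?_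
      exact (N.toCompl_mul 1 x).symm.trans (by rw [one_mul])
    mul_one := fun x => by
      change x * (1 : N.Compl) = x
      refine induction_on x (isClosed_eq (by fun_prop) (by fun_prop)) fun x => ?_
      exact (N.toCompl_mul x 1).symm.trans (by rw [mul_one]) }

/-- The completion of a unital *-algebra is a unital C*-algebra. -/
@[reducible] def unitalCompl (N : CStarSeminorm R) : CStarAlgebra N.Compl :=
  letI ring : NormedRing N.Compl := N.unitalRing
  letI alg : NormedAlgebra ℂ N.Compl :=
    { Algebra.ofModule (fun c x y => smul_mul_assoc c x y) (fun c x y => mul_smul_comm c x y) with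
      norm_smul_le := norm_smul_le }
  { ring, alg, (inferInstance : StarRing N.Compl) with
    complete := (inferInstance : CompleteSpace N.Compl).complete
    norm_mul_self_le := (inferInstance : CStarRing N.Compl).norm_mul_self_le
    star_smul := (inferInstance : StarModule ℂ N.Compl).star_smul }

end Unital

end CStarSeminorm

/-! ### The full group C*-algebra of a discrete group -/

section GroupAlgebra

variable {G : Type v} [Group G]

/-- The involution `(∑ c_s s)* = ∑ (conj c_s) s⁻¹` of the complex group algebra. -/
instance : Star (MonoidAlgebra ℂ G) where
  star x := .ofCoeff ((x.coeff.mapRange star (star_zero ℂ)).equivMapDomain (Equiv.inv G))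

theorem star_single (s : G) (c : ℂ) :
    star (MonoidAlgebra.single s c) = MonoidAlgebra.single s⁻¹ (star c) := by
  change MonoidAlgebra.ofCoeff (((Finsupp.single s c).mapRange star (star_zero ℂ)).equivMapDomain
    (Equiv.inv G)) = MonoidAlgebra.ofCoeff (Finsupp.single s⁻¹ (star c))
  rw [Finsupp.mapRange_single, Finsupp.equivMapDomain_single]
  rfl

theorem coeff_star (x : MonoidAlgebra ℂ G) (s : G) : (star x).coeff s = star (x.coeff s⁻¹) := rfl

theorem groupAlgebra_star_add (x y : MonoidAlgebra ℂ G) : star (x + y) = star x + star y := by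
  ext s
  simp [coeff_star]

instance : StarRing (MonoidAlgebra ℂ G) where
  star_involutive x := by
    ext s
    simp [coeff_star]
  star_add := groupAlgebra_star_add
  star_mul x y := by
    induction x using MonoidAlgebra.induction_linear with
    | zero => simp [show star (0 : MonoidAlgebra ℂ G) = 0 by ext s; simp [coeff_star]]
    | add x₁ x₂ h₁ h₂ => rw [add_mul, groupAlgebra_star_add, groupAlgebra_star_add, h₁, h₂, mul_add]
    | single s c =>
      induction y using MonoidAlgebra.induction_linear with
      | zero => simp [show star (0 : MonoidAlgebra ℂ G) = 0 by ext s; simp [coeff_star]]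
      | add y₁ y₂ h₁ h₂ =>
        rw [mul_add, groupAlgebra_star_add, groupAlgebra_star_add, h₁, h₂, add_mul]
      | single t d =>
        simp [MonoidAlgebra.single_mul_single, star_single, mul_comm]

instance : StarModule ℂ (MonoidAlgebra ℂ G) where
  star_smul c x := by
    ext s
    simp [coeff_star]

theorem CStarSeminorm.groupAlgebra_single_le (p : CStarSeminorm (MonoidAlgebra ℂ G)) (s : G) :
    p (MonoidAlgebra.single s 1) ≤ 1 := by
  have h1 : p 1 ≤ 1 := by
    have h := p.star_mul_self 1
    rw [star_one, one_mul] at h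
    nlinarith [p.nonneg 1]
  have h2 := p.star_mul_self (MonoidAlgebra.single s 1)
  rw [star_single, MonoidAlgebra.single_mul_single, inv_mul_cancel, star_one, one_mul,
    ← MonoidAlgebra.one_def] at h2
  nlinarith [p.nonneg (MonoidAlgebra.single s 1)]

theorem CStarSeminorm.groupAlgebra_bounded (x : MonoidAlgebra ℂ G) :
    ∃ C : ℝ, ∀ p ∈ (Set.univ : Set (CStarSeminorm (MonoidAlgebra ℂ G))), p x ≤ C := by
  induction x using MonoidAlgebra.induction_linear with
  | zero => exact ⟨0, fun p _ => (map_zero p.toSeminorm).le⟩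
  | add x y hx hy =>
    obtain ⟨C, hC⟩ := hx
    obtain ⟨D, hD⟩ := hy
    exact ⟨C + D, fun p hp => (map_add_le_add p.toSeminorm x y).trans
      (add_le_add (hC p hp) (hD p hp))⟩
  | single s c =>
    refine ⟨‖c‖, fun p _ => ?_⟩
    have : MonoidAlgebra.single s c = c • MonoidAlgebra.single s (1 : ℂ) := by simp
    rw [this, map_smul_eq_mul]
    exact mul_le_of_le_one_right (norm_nonneg c) (p.groupAlgebra_single_le s)

variable (G)

/-- The largest C*-seminorm on the complex group algebra. -/
def groupNorm : CStarSeminorm (MonoidAlgebra ℂ G) :=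
  CStarSeminorm.sup Set.univ ⟨CStarSeminorm.zero, trivial⟩ CStarSeminorm.groupAlgebra_bounded

/-- The full group C*-algebra `C*(G)`: the completion of the complex group algebra in its largest
C*-seminorm. -/
def GroupCStar : Type v := (groupNorm G).Compl

instance : CStarAlgebra (GroupCStar G) := (groupNorm G).unitalCompl

variable {G}

/-- The canonical image of `s ∈ G` in `C*(G)`. -/
def groupU (s : G) : GroupCStar G := (groupNorm G).toCompl (MonoidAlgebra.single s 1)

theorem groupU_one : groupU (1 : G) = 1 := rfl

theorem groupU_mul (s t : G) : groupU (s * t) = groupU s * groupU t := by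
  have := (groupNorm G).toCompl_mul (MonoidAlgebra.single s 1) (MonoidAlgebra.single t 1)
  rw [MonoidAlgebra.single_mul_single, one_mul] at this
  exact this

theorem groupU_inv (s : G) : groupU s⁻¹ = star (groupU s) := by
  have := (groupNorm G).toCompl_star (MonoidAlgebra.single s 1)
  rw [star_single, star_one] at this
  exact this

section Lift

variable {D : Type w} [NonUnitalCStarAlgebra D] (u : G →ₙ* D) (hu : ∀ s, u s⁻¹ = star (u s))

/-- The linear extension to the group algebra of a map `u` from `G` to a C*-algebra with
`u (s t) = u s u t` and `u s⁻¹ = (u s)*`. -/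
def groupAlgLift : MonoidAlgebra ℂ G →⋆ₙₐ[ℂ] D :=
  { MonoidAlgebra.liftMagma ℂ u with
    map_star' := fun x => by
      change MonoidAlgebra.liftMagma ℂ u (star x) = star (MonoidAlgebra.liftMagma ℂ u x)
      induction x using MonoidAlgebra.induction_linear with
      | zero => simp
      | add x y hx hy => rw [star_add, map_add, map_add, star_add, hx, hy]
      | single s c => simp [star_single, hu] }

theorem norm_groupAlgLift_le (x : MonoidAlgebra ℂ G) : ‖groupAlgLift u hu x‖ ≤ groupNorm G x :=
  CStarSeminorm.le_sup (p := CStarSeminorm.comap (groupAlgLift u hu)) _ _ (Set.mem_univ _) x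

/-- The extension of `u` to a *-homomorphism of `C*(G)`. -/
def groupLift : GroupCStar G →⋆ₙₐ[ℂ] D :=
  (groupNorm G).lift (groupAlgLift u hu) (norm_groupAlgLift_le u hu)

theorem groupLift_groupU (s : G) : groupLift u hu (groupU s) = u s := by
  refine ((groupNorm G).lift_toCompl (groupAlgLift u hu) (norm_groupAlgLift_le u hu) _).trans ?_
  change MonoidAlgebra.liftMagma ℂ u (MonoidAlgebra.single s 1) = u s
  simp

end Lift

end GroupAlgebra

/-! ### The maximal tensor product -/

section MaxTensor

variable (A : Type u) (B : Type v) [NonUnitalCStarAlgebra A] [NonUnitalCStarAlgebra B]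

/-- The C*-seminorms on the algebraic tensor product with `p (a ⊗ b) ≤ ‖a‖ ‖b‖`. (Every C*-seminorm
on `A ⊗ B` has this property.) -/
def crossSeminorms : Set (CStarSeminorm (A ⊗[ℂ] B)) :=
  {p | ∀ (a : A) (b : B), p (a ⊗ₜ[ℂ] b) ≤ ‖a‖ * ‖b‖}

theorem crossSeminorms_bounded (x : A ⊗[ℂ] B) :
    ∃ C : ℝ, ∀ p ∈ crossSeminorms A B, p x ≤ C := by
  induction x using TensorProduct.induction_on with
  | zero => exact ⟨0, fun p _ => (map_zero p.toSeminorm).le⟩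
  | add x y hx hy =>
    obtain ⟨C, hC⟩ := hx
    obtain ⟨D, hD⟩ := hy
    exact ⟨C + D, fun p hp => (map_add_le_add p.toSeminorm x y).trans
      (add_le_add (hC p hp) (hD p hp))⟩
  | tmul a b => exact ⟨‖a‖ * ‖b‖, fun p hp => hp a b⟩

/-- The maximal C*-norm on the algebraic tensor product. -/
def maxNorm : CStarSeminorm (A ⊗[ℂ] B) :=
  CStarSeminorm.sup (crossSeminorms A B)
    ⟨CStarSeminorm.zero, fun a b => mul_nonneg (norm_nonneg a) (norm_nonneg b)⟩
    (crossSeminorms_bounded A B)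

/-- The maximal C*-tensor product `A ⊗ B`. -/
def MaxTensor : Type (max u v) := (maxNorm A B).Compl

instance : NonUnitalCStarAlgebra (MaxTensor A B) :=
  inferInstanceAs (NonUnitalCStarAlgebra (maxNorm A B).Compl)

variable {A B}

namespace MaxTensor

/-- The canonical map from the algebraic to the maximal tensor product. -/
def ofAlg : A ⊗[ℂ] B →ₗ[ℂ] MaxTensor A B := (maxNorm A B).toCompl

theorem ofAlg_mul (x y : A ⊗[ℂ] B) : ofAlg (x * y) = ofAlg x * ofAlg y :=
  (maxNorm A B).toCompl_mul x y

theorem ofAlg_star (x : A ⊗[ℂ] B) : ofAlg (star x) = star (ofAlg x) :=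
  (maxNorm A B).toCompl_star x

@[elab_as_elim]
theorem induction_on {P : MaxTensor A B → Prop} (x : MaxTensor A B) (hc : IsClosed {x | P x})
    (h : ∀ x : A ⊗[ℂ] B, P (ofAlg x)) : P x :=
  CStarSeminorm.induction_on (N := maxNorm A B) x hc h

/-- The elementary tensor `a ⊗ b`, bilinearly in `a` and `b`. -/
def tmulₗ : A →ₗ[ℂ] B →ₗ[ℂ] MaxTensor A B :=
  (TensorProduct.mk ℂ A B).compr₂ ofAlg

/-- The elementary tensor `a ⊗ b`. -/
def tmul (a : A) (b : B) : MaxTensor A B := tmulₗ a b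

theorem ofAlg_tmul (a : A) (b : B) : ofAlg (a ⊗ₜ[ℂ] b) = tmul a b := rfl

theorem tmul_mul (a a' : A) (b b' : B) : tmul a b * tmul a' b' = tmul (a * a') (b * b') := by
  rw [← ofAlg_tmul, ← ofAlg_tmul, ← ofAlg_mul, Algebra.TensorProduct.tmul_mul_tmul, ofAlg_tmul]

theorem star_tmul (a : A) (b : B) : star (tmul a b) = tmul (star a) (star b) := by
  rw [← ofAlg_tmul, ← ofAlg_star, TensorProduct.star_tmul, ofAlg_tmul]

theorem norm_tmul_le (a : A) (b : B) : ‖tmul a b‖ ≤ ‖a‖ * ‖b‖ :=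
  ((maxNorm A B).norm_toCompl _).le.trans
    (CStarSeminorm.sup_le _ _ fun _ hp => hp a b)

section Lift

variable {D : Type w} [NonUnitalCStarAlgebra D] (β : A →ₗ[ℂ] B →ₗ[ℂ] D)
  (hmul : ∀ a a' b b', β a b * β a' b' = β (a * a') (b * b'))
  (hstar : ∀ a b, star (β a b) = β (star a) (star b))

/-- The *-homomorphism on the algebraic tensor product given by a multiplicative and *-preserving
bilinear map. -/
def algLift : A ⊗[ℂ] B →⋆ₙₐ[ℂ] D where
  __ := TensorProduct.lift β
  toFun := TensorProduct.lift β
  map_zero' := map_zero _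
  map_mul' x y := by
    induction x using TensorProduct.induction_on with
    | zero => simp
    | add x₁ x₂ h₁ h₂ => rw [add_mul, map_add, map_add, add_mul, h₁, h₂]
    | tmul a b =>
      induction y using TensorProduct.induction_on with
      | zero => simp
      | add y₁ y₂ h₁ h₂ => rw [mul_add, map_add, map_add, mul_add, h₁, h₂]
      | tmul a' b' => simp [Algebra.TensorProduct.tmul_mul_tmul, hmul]
  map_star' x := by
    induction x using TensorProduct.induction_on with
    | zero => simp
    | add x y hx hy => rw [star_add, map_add, map_add, star_add, hx, hy]
    | tmul a b => simp [hstar]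

theorem norm_algLift_le (hnorm : ∀ a b, ‖β a b‖ ≤ ‖a‖ * ‖b‖) (x : A ⊗[ℂ] B) : ‖algLift β hmul hstar x‖ ≤ maxNorm A B x := by
  refine CStarSeminorm.le_sup (S := crossSeminorms A B)
    (p := CStarSeminorm.comap (algLift β hmul hstar)) _ _ (fun a b => ?_) x
  exact hnorm a b

/-- The extension of a multiplicative, *-preserving and contractive bilinear map to the maximal
tensor product. -/
def lift (hnorm : ∀ a b, ‖β a b‖ ≤ ‖a‖ * ‖b‖) : MaxTensor A B →⋆ₙₐ[ℂ] D :=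
  (maxNorm A B).lift (algLift β hmul hstar) (norm_algLift_le β hmul hstar hnorm)

theorem lift_tmul (hnorm : ∀ a b, ‖β a b‖ ≤ ‖a‖ * ‖b‖) (a : A) (b : B) : lift β hmul hstar hnorm (tmul a b) = β a b :=
  (maxNorm A B).lift_toCompl (algLift β hmul hstar) (norm_algLift_le β hmul hstar hnorm) _

end Lift

section Map

variable {A' B' : Type*} [NonUnitalCStarAlgebra A'] [NonUnitalCStarAlgebra B']

/-- The tensor product `φ ⊗ ψ` of two *-homomorphisms. -/
def map (φ : A →⋆ₙₐ[ℂ] A') (ψ : B →⋆ₙₐ[ℂ] B') : MaxTensor A B →⋆ₙₐ[ℂ] MaxTensor A' B' :=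
  lift (tmulₗ.compl₁₂ (φ : A →ₗ[ℂ] A') (ψ : B →ₗ[ℂ] B'))
    (fun a a' b b' => by
      change tmul (φ a) (ψ b) * tmul (φ a') (ψ b') = tmul (φ (a * a')) (ψ (b * b'))
      rw [tmul_mul, map_mul, map_mul])
    (fun a b => by
      change star (tmul (φ a) (ψ b)) = tmul (φ (star a)) (ψ (star b))
      rw [star_tmul, map_star, map_star])
    (fun a b => (norm_tmul_le (φ a) (ψ b)).trans
      (mul_le_mul (NonUnitalStarAlgHom.norm_apply_le φ a) (NonUnitalStarAlgHom.norm_apply_le ψ b)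
        (norm_nonneg _) (norm_nonneg _)))

theorem map_tmul (φ : A →⋆ₙₐ[ℂ] A') (ψ : B →⋆ₙₐ[ℂ] B') (a : A) (b : B) :
    map φ ψ (tmul a b) = tmul (φ a) (ψ b) :=
  lift_tmul _ _ _ _ a b

end Map

section Assoc

variable {C : Type w} [CStarAlgebra C]

/-- For `c ∈ C`, the linear map `a ⊗ b ↦ a ⊗ (b ⊗ c)` on the algebraic tensor product. -/
def legₗ (c : C) : A ⊗[ℂ] B →ₗ[ℂ] MaxTensor A (MaxTensor B C) :=
  TensorProduct.lift (tmulₗ.compl₂ (tmulₗ.flip c))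

theorem legₗ_tmul (c : C) (a : A) (b : B) : legₗ c (a ⊗ₜ[ℂ] b) = tmul a (tmul b c) := rfl

theorem legₗ_mul (c d : C) (x y : A ⊗[ℂ] B) :
    legₗ c x * legₗ d y = legₗ (c * d) (x * y) := by
  induction x using TensorProduct.induction_on with
  | zero => simp
  | add x₁ x₂ h₁ h₂ => rw [add_mul, map_add, map_add, add_mul, h₁, h₂]
  | tmul a b =>
    induction y using TensorProduct.induction_on with
    | zero => simp
    | add y₁ y₂ h₁ h₂ => rw [mul_add, map_add, map_add, mul_add, h₁, h₂]
    | tmul a' b' =>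
      simp only [Algebra.TensorProduct.tmul_mul_tmul, legₗ_tmul, tmul_mul]

theorem star_legₗ (c : C) (x : A ⊗[ℂ] B) : star (legₗ c x) = legₗ (star c) (star x) := by
  induction x using TensorProduct.induction_on with
  | zero => simp
  | add x y hx hy => rw [star_add, map_add, map_add, star_add, hx, hy]
  | tmul a b => simp only [TensorProduct.star_tmul, legₗ_tmul, star_tmul]

theorem legₗ_add (c d : C) (x : A ⊗[ℂ] B) : legₗ (c + d) x = legₗ c x + legₗ d x := by
  induction x using TensorProduct.induction_on with
  | zero => simp
  | add x y hx hy => rw [map_add, map_add, map_add, hx, hy]; abel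
  | tmul a b => simp only [legₗ_tmul, tmul, map_add]

theorem legₗ_smul (r : ℂ) (c : C) (x : A ⊗[ℂ] B) : legₗ (r • c) x = r • legₗ c x := by
  induction x using TensorProduct.induction_on with
  | zero => simp
  | add x y hx hy => rw [map_add, map_add, smul_add, hx, hy]
  | tmul a b => simp only [legₗ_tmul, tmul, map_smul]

theorem norm_legₗ_one_le (x : A ⊗[ℂ] B) : ‖legₗ (1 : C) x‖ ≤ maxNorm A B x := by
  let f : A ⊗[ℂ] B →⋆ₙₐ[ℂ] MaxTensor A (MaxTensor B C) :=
    { legₗ (1 : C) with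
      map_zero' := map_zero _
      map_mul' := fun x y => by
        change legₗ (1 : C) (x * y) = legₗ (1 : C) x * legₗ (1 : C) y
        rw [legₗ_mul, mul_one]
      map_star' := fun x => by
        change legₗ (1 : C) (star x) = star (legₗ (1 : C) x)
        rw [star_legₗ, star_one] }
  refine CStarSeminorm.le_sup (p := CStarSeminorm.comap f) _ _ (fun a b => ?_) x
  change ‖tmul a (tmul b (1 : C))‖ ≤ ‖a‖ * ‖b‖
  have h1 : ‖(1 : C)‖ ≤ 1 := by
    have := CStarRing.norm_star_mul_self (x := (1 : C))
    rw [star_one, one_mul] at this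
    nlinarith [norm_nonneg (1 : C)]
  refine (norm_tmul_le _ _).trans (mul_le_mul_of_nonneg_left ?_ (norm_nonneg a))
  exact (norm_tmul_le _ _).trans (mul_le_of_le_one_right (norm_nonneg b) h1)

open scoped CStarAlgebra in
theorem norm_legₗ_le (c : C) (x : A ⊗[ℂ] B) : ‖legₗ c x‖ ≤ ‖c‖ * maxNorm A B x := by
  let _ := CStarAlgebra.spectralOrder C
  have := CStarAlgebra.spectralOrderedRing C
  let _ := CStarAlgebra.spectralOrder (MaxTensor A (MaxTensor B C))
  have := CStarAlgebra.spectralOrderedRing (MaxTensor A (MaxTensor B C))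
  obtain ⟨e, he⟩ : ∃ e : C, ((‖c‖ ^ 2 : ℝ) : ℂ) • (1 : C) - star c * c = star e * e := by
    have : star c * c ≤ ((‖c‖ ^ 2 : ℝ) : ℂ) • (1 : C) := by
      have := CStarAlgebra.star_mul_le_algebraMap_norm_sq (a := c)
      rwa [Algebra.algebraMap_eq_smul_one, ← Complex.coe_smul] at this
    exact CStarAlgebra.nonneg_iff_eq_star_mul_self.mp (sub_nonneg.mpr this)
  have h1 : ((‖c‖ ^ 2 : ℝ) : ℂ) • (star (legₗ (1 : C) x) * legₗ (1 : C) x) -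
      star (legₗ c x) * legₗ c x = star (legₗ e x) * legₗ e x := by
    rw [star_legₗ, star_legₗ, star_legₗ, legₗ_mul, legₗ_mul, legₗ_mul, ← he, star_one, one_mul,
      sub_eq_add_neg, sub_eq_add_neg, legₗ_add, legₗ_smul, ← neg_one_smul ℂ (star c * c),
      legₗ_smul, neg_one_smul]
  have h2 : star (legₗ c x) * legₗ c x ≤
      ((‖c‖ ^ 2 : ℝ) : ℂ) • (star (legₗ (1 : C) x) * legₗ (1 : C) x) := by
    rw [← sub_nonneg, h1]
    exact star_mul_self_nonneg _
  have h3 := CStarAlgebra.norm_le_norm_of_nonneg_of_le (star_mul_self_nonneg _) h2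
  rw [norm_smul, CStarRing.norm_star_mul_self, CStarRing.norm_star_mul_self] at h3
  have h4 : ‖((‖c‖ ^ 2 : ℝ) : ℂ)‖ = ‖c‖ ^ 2 := by simp
  rw [h4] at h3
  have h5 : ‖legₗ c x‖ ≤ ‖c‖ * ‖legₗ (1 : C) x‖ := by
    refine abs_le_of_sq_le_sq' ?_ (by positivity) |>.2
    nlinarith
  exact h5.trans (mul_le_mul_of_nonneg_left (norm_legₗ_one_le x) (norm_nonneg c))

/-- For `c ∈ C`, the bounded linear map `a ⊗ b ↦ a ⊗ (b ⊗ c)`. -/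
def leg (c : C) : MaxTensor A B →L[ℂ] MaxTensor A (MaxTensor B C) :=
  (maxNorm A B).extendL (legₗ c) ‖c‖ (norm_legₗ_le c)

theorem leg_ofAlg (c : C) (x : A ⊗[ℂ] B) : leg c (ofAlg x) = legₗ c x :=
  (maxNorm A B).extendL_toCompl (legₗ c) ‖c‖ (norm_legₗ_le c) x

theorem leg_add (c d : C) (x : MaxTensor A B) : leg (c + d) x = leg c x + leg d x := by
  refine induction_on x (isClosed_eq (by fun_prop) (by fun_prop)) fun x => ?_
  rw [leg_ofAlg, leg_ofAlg, leg_ofAlg, legₗ_add]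

theorem leg_smul (r : ℂ) (c : C) (x : MaxTensor A B) : leg (r • c) x = r • leg c x := by
  refine induction_on x (isClosed_eq (by fun_prop) ((leg c).continuous.const_smul r)) fun x => ?_
  rw [leg_ofAlg, leg_ofAlg, legₗ_smul]

theorem leg_mul (c d : C) (x y : MaxTensor A B) : leg c x * leg d y = leg (c * d) (x * y) := by
  refine induction_on x (isClosed_eq (by fun_prop) (by fun_prop)) fun x => ?_
  refine induction_on y (isClosed_eq (by fun_prop) (by fun_prop)) fun y => ?_
  rw [← ofAlg_mul, leg_ofAlg, leg_ofAlg, leg_ofAlg, legₗ_mul]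

theorem star_leg (c : C) (x : MaxTensor A B) : star (leg c x) = leg (star c) (star x) := by
  refine induction_on x (isClosed_eq (by fun_prop) (by fun_prop)) fun x => ?_
  rw [← ofAlg_star, leg_ofAlg, leg_ofAlg, star_legₗ]

theorem norm_leg_le (c : C) (x : MaxTensor A B) : ‖leg c x‖ ≤ ‖x‖ * ‖c‖ := by
  rw [mul_comm]
  exact (maxNorm A B).norm_extendL_le (legₗ c) ‖c‖ (norm_legₗ_le c) x

/-- The bilinear map `(x, c) ↦ leg c x`. -/
def legBilin : MaxTensor A B →ₗ[ℂ] C →ₗ[ℂ] MaxTensor A (MaxTensor B C) :=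
  LinearMap.mk₂ ℂ (fun x c => leg c x) (fun x y _ => map_add _ x y) (fun r x _ => map_smul _ r x)
    (fun x c d => leg_add c d x) (fun r x c => leg_smul r c x)

/-- The canonical *-homomorphism `(A ⊗ B) ⊗ C → A ⊗ (B ⊗ C)`, for unital `C`. -/
def assoc : MaxTensor (MaxTensor A B) C →⋆ₙₐ[ℂ] MaxTensor A (MaxTensor B C) :=
  lift legBilin (fun x y c d => leg_mul c d x y) (fun x c => star_leg c x)
    (fun x c => norm_leg_le c x)

theorem assoc_tmul (a : A) (b : B) (c : C) :
    assoc (tmul (tmul a b) c) = tmul a (tmul b c) :=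
  (lift_tmul _ _ _ _ _ _).trans (leg_ofAlg c (a ⊗ₜ[ℂ] b))

end Assoc

end MaxTensor

end MaxTensor

/-! ### Coactions of a discrete group -/

section Coactions

variable (G : Type v) [Group G]

/-- The comultiplication `δ_G : C*(G) → C*(G) ⊗ C*(G)`, `s ↦ s ⊗ s`. -/
def comult : GroupCStar G →⋆ₙₐ[ℂ] MaxTensor (GroupCStar G) (GroupCStar G) :=
  groupLift
    { toFun := fun s => MaxTensor.tmul (groupU s) (groupU s)
      map_mul' := fun s t => by rw [MaxTensor.tmul_mul, groupU_mul] }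
    (fun s => by
      change MaxTensor.tmul (groupU s⁻¹) (groupU s⁻¹) = star (MaxTensor.tmul (groupU s) (groupU s))
      rw [MaxTensor.star_tmul, groupU_inv])

theorem comult_groupU (s : G) :
    comult G (groupU s) = MaxTensor.tmul (groupU s) (groupU s) :=
  groupLift_groupU _ _ s

/-- A coaction of the discrete group `G` on the C*-algebra `A`: an injective *-homomorphism
`δ : A → A ⊗ C*(G)` that is nondegenerate, `δ(A)(A ⊗ C*(G))` spanning a dense subspace, and
satisfies the coaction identity `(δ ⊗ id) ∘ δ = (id ⊗ δ_G) ∘ δ`. -/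
structure Coaction (A : Type u) [NonUnitalCStarAlgebra A] where
  toHom : A →⋆ₙₐ[ℂ] MaxTensor A (GroupCStar G)
  injective : Function.Injective toHom
  nondegenerate : Dense (Submodule.span ℂ
    {y : MaxTensor A (GroupCStar G) | ∃ a x, y = toHom a * x} : Set (MaxTensor A (GroupCStar G)))
  coassoc : ∀ a, MaxTensor.assoc (MaxTensor.map toHom (NonUnitalStarAlgHom.id ℂ _) (toHom a)) =
    MaxTensor.map (NonUnitalStarAlgHom.id ℂ A) (comult G) (toHom a)

variable {G} {A : Type u} [NonUnitalCStarAlgebra A] (δ : Coaction G A)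

namespace Coaction

/-- The spectral subspace `A_s = {a ∈ A : δ(a) = a ⊗ s}`. -/
def spectralSubspace (s : G) : Submodule ℂ A where
  carrier := {a | δ.toHom a = MaxTensor.tmul a (groupU s)}
  zero_mem' := by simp [MaxTensor.tmul]
  add_mem' {a b} ha hb := by
    simp only [Set.mem_ofPred_eq, MaxTensor.tmul, map_add, LinearMap.add_apply] at *
    rw [ha, hb]
  smul_mem' c a ha := by
    simp only [Set.mem_ofPred_eq, MaxTensor.tmul, map_smul, LinearMap.smul_apply] at *
    rw [ha]

/-- The fixed point algebra `A^δ = A_1`. -/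
def fixedPointAlgebra : NonUnitalStarSubalgebra ℂ A where
  __ := δ.spectralSubspace 1
  mul_mem' {a b} ha hb := by
    change δ.toHom a = MaxTensor.tmul a (groupU 1) at ha
    change δ.toHom b = MaxTensor.tmul b (groupU 1) at hb
    change δ.toHom (a * b) = MaxTensor.tmul (a * b) (groupU 1)
    rw [map_mul, ha, hb, MaxTensor.tmul_mul, ← groupU_mul, mul_one]
  star_mem' {a} ha := by
    change δ.toHom a = MaxTensor.tmul a (groupU 1) at ha
    change δ.toHom (star a) = MaxTensor.tmul (star a) (groupU 1)
    rw [map_star, ha, MaxTensor.star_tmul, ← groupU_inv, inv_one]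

end Coaction

/-! ### Covariant representations and the crossed product -/

/-- A representation on a Hilbert space is nondegenerate if the vectors `π(a) h` span a dense
subspace. -/
def IsNondegenerate {B : Type u} [NonUnitalCStarAlgebra B] {H : Type w} [NormedAddCommGroup H]
    [InnerProductSpace ℂ H] [CompleteSpace H] (π : B →⋆ₙₐ[ℂ] (H →L[ℂ] H)) : Prop :=
  Dense (Submodule.span ℂ {h : H | ∃ b k, h = π b k} : Set H)

/-- The characteristic function `χ_s` of `{s}`, as an element of `C₀(G)`. -/
def chi {G : Type v} [TopologicalSpace G] [DiscreteTopology G] (s : G) : C₀(G, ℂ) where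
  toFun := Set.indicator {s} 1
  continuous_toFun := continuous_of_discreteTopology
  zero_at_infty' := by
    refine tendsto_const_nhds.congr' ?_
    filter_upwards [(isCompact_singleton (x := s)).compl_mem_cocompact] with t ht
    exact (Set.indicator_of_notMem ht 1).symm

/-- A covariant representation `(π, μ)` of `(A, G, δ)` on a Hilbert space. -/
structure CovariantRep {G : Type v} [Group G] [TopologicalSpace G] [DiscreteTopology G]
    {A : Type u} [NonUnitalCStarAlgebra A] (δ : Coaction G A) where
  H : Type (max u v)
  [normedAddCommGroup : NormedAddCommGroup H]
  [innerProductSpace : InnerProductSpace ℂ H]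
  [completeSpace : CompleteSpace H]
  π : A →⋆ₙₐ[ℂ] (H →L[ℂ] H)
  μ : C₀(G, ℂ) →⋆ₙₐ[ℂ] (H →L[ℂ] H)
  nondegenerate_π : IsNondegenerate π
  nondegenerate_μ : IsNondegenerate μ
  covariant : ∀ (s t : G), ∀ a ∈ δ.spectralSubspace s, π a * μ (chi t) = μ (chi (s * t)) * π a

attribute [instance] CovariantRep.normedAddCommGroup CovariantRep.innerProductSpace
  CovariantRep.completeSpace

namespace Coaction

variable {G : Type v} [Group G] [TopologicalSpace G] [DiscreteTopology G]
  {A : Type u} [NonUnitalCStarAlgebra A] (δ : Coaction G A)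

/-- The C*-algebra `∏ B(H)` of bounded families of operators, indexed by all covariant
representations of `(A, G, δ)`. It acts, block-diagonally, on the Hilbert space direct sum of all
covariant representations. -/
def Ambient : Type (max u v + 1) :=
  lp (fun ρ : CovariantRep δ => ρ.H →L[ℂ] ρ.H) ∞

instance : NonUnitalCStarAlgebra δ.Ambient :=
  inferInstanceAs (NonUnitalCStarAlgebra (lp (fun ρ : CovariantRep δ => ρ.H →L[ℂ] ρ.H) ∞))

/-- The *-homomorphism into `∏ B(H)` given by a family of representations. -/
def family {B : Type w} [NonUnitalCStarAlgebra B]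
    (φ : ∀ ρ : CovariantRep δ, B →⋆ₙₐ[ℂ] (ρ.H →L[ℂ] ρ.H)) : B →⋆ₙₐ[ℂ] δ.Ambient where
  toFun b := ⟨fun ρ => φ ρ b, memℓp_infty ⟨‖b‖, by
    rintro _ ⟨ρ, rfl⟩
    exact NonUnitalStarAlgHom.norm_apply_le (φ ρ) b⟩⟩
  map_smul' c b := Subtype.ext <| funext fun ρ => map_smul (φ ρ) c b
  map_zero' := Subtype.ext <| funext fun ρ => map_zero (φ ρ)
  map_add' b c := Subtype.ext <| funext fun ρ => map_add (φ ρ) b c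
  map_mul' b c := Subtype.ext <| funext fun ρ => map_mul (φ ρ) b c
  map_star' b := Subtype.ext <| funext fun ρ => map_star (φ ρ) b

/-- The first component `j_A` of the universal covariant representation `(j_A, j_G)`: the direct
sum of the `π` over all covariant representations `(π, μ)`. -/
def jA : A →⋆ₙₐ[ℂ] δ.Ambient := δ.family fun ρ => ρ.π

/-- The second component `j_G` of the universal covariant representation `(j_A, j_G)`: the direct
sum of the `μ` over all covariant representations `(π, μ)`. -/
def jG : C₀(G, ℂ) →⋆ₙₐ[ℂ] δ.Ambient := δ.family fun ρ => ρ.μ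

/-- The crossed product `A ×_δ G`: the C*-algebra generated by the products `j_A(a) j_G(f)` of the
universal covariant representation. -/
def crossedProduct : NonUnitalStarSubalgebra ℂ δ.Ambient :=
  (NonUnitalStarAlgebra.adjoin ℂ
    {x : δ.Ambient | ∃ (a : A) (f : C₀(G, ℂ)), x = δ.jA a * δ.jG f}).topologicalClosure

end Coaction

end Coactions

end DiscreteCoaction

end

open scoped TensorProduct ENNReal ZeroAtInfty

noncomputable section

namespace DiscreteCoaction

universe u v w

/-! The isomorphism is `a ↦ j_A(a) j_G(χ_1)` on `A_1` (`cornerHom`). By covariance `j_A(a)` commutes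
with the projection `j_G(χ_1)` when `a ∈ A_1`, so this is a *-homomorphism into the corner.

Injectivity (`injective_cornerHom`) is seen in one covariant representation: for a faithful `π` on
`H`, the pair `((π ⊗ λ) ∘ δ, 1 ⊗ M)` on `ℓ²(G, H)` sends `e_1 ⊗ h` to `e_1 ⊗ π(a)h`. Faithful
nondegenerate `π` come from sums of GNS representations.

Surjectivity rests on the density of `⨁ A_s` in `A` (`dense_iSup_spectralSubspace`). Given it, `A
×_δ G` lies in the closed span of the products `j_A(a) j_G(χ_t)` with `a ∈ A_s`. Compressing such a
product by `j_G(χ_1)` gives `j_A(a) j_G(χ_{s⁻¹} χ_t χ_1)`, which vanishes unless `s = t = 1`. The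
range of an injective *-homomorphism of C*-algebras is closed, so the whole corner is reached.

For the density, let `D(a ⊗ s) = (a ⊗ s) ⊗ s`; the coaction identity reads `(δ ⊗ id) ∘ δ = D ∘ δ`.
Let `ε(a ⊗ s) = a`, let `E_t` be the slice at `t`, and let `Θ((a ⊗ s) ⊗ t)` be `a` if `s = t` and
`0` otherwise. Then `Θ ∘ D = ε` and `ε ∘ δ = id`, so `a = Θ((δ ⊗ id)(δ(a)))`. But `Θ(δ(b) ⊗ t) =
E_t(δ(b))` lies in `A_t`, so `Θ ∘ (δ ⊗ id)` takes all its values in the closed span of the spectral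
subspaces. -/

/-! ### Faithful representations -/

section FaithfulRepresentation

open scoped ComplexOrder ComplexStarModule

/-- Every nonzero positive element of a C*-algebra is detected by a positive functional. -/
theorem exists_positive_apply_ne_zero {A : Type u} [NonUnitalCStarAlgebra A] [PartialOrder A]
    [StarOrderedRing A] {c : A} (hc : 0 ≤ c) (hc0 : c ≠ 0) : ∃ f : A →ₚ[ℂ] ℂ, f c ≠ 0 := by
  have hneg : -c ∉ ProperCone.positive ℝ A := fun h => by
    rw [ProperCone.mem_positive, neg_nonneg] at h
    exact hc0 (le_antisymm h hc)
  -- Hahn–Banach separates `-c` from the closed positive cone by a real functional; its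
  -- complexification `F` through real and imaginary parts is the functional sought.
  obtain ⟨f, hf, hfc⟩ := ProperCone.hyperplane_separation_point _ hneg
  let F : A →ₗ[ℂ] ℂ :=
    { toFun := fun x => (f (ℜ x : A) : ℂ) + Complex.I * (f (ℑ x : A) : ℂ)
      map_add' := fun x y => by
        simp only [map_add, AddSubgroup.coe_add, Complex.ofReal_add]
        ring
      map_smul' := fun z x => by
        simp only [realPart_smul, imaginaryPart_smul, AddSubgroup.coe_sub, AddSubgroup.coe_add,
          selfAdjoint.val_smul, map_sub, map_add, map_smul, smul_eq_mul, RingHom.id_apply,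
          Complex.ofReal_sub, Complex.ofReal_add, Complex.ofReal_mul]
        conv_rhs => rw [← Complex.re_add_im z]
        linear_combination (-(z.im : ℂ) * (f (ℑ x : A) : ℂ)) * Complex.I_sq }
  have hF : ∀ x : A, 0 ≤ x → F x = f x := fun x hx => by
    have hx' : IsSelfAdjoint x := .of_nonneg hx
    simp [F, hx'.coe_realPart, hx'.imaginaryPart]
  refine ⟨PositiveLinearMap.mk₀ F fun x hx => ?_, ?_⟩
  · rw [hF x hx]
    exact Complex.zero_le_real.mpr (hf x hx)
  · change F c ≠ 0
    rw [hF c hc, Complex.ofReal_ne_zero]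
    rw [map_neg] at hfc
    linarith

/-- A C*-algebra is spanned by the products of its elements. -/
theorem mem_span_mul {A : Type u} [NonUnitalCStarAlgebra A] (a : A) :
    a ∈ Submodule.span ℂ {x : A | ∃ b c, x = b * c} := by
  let _ := CStarAlgebra.spectralOrder A
  have := CStarAlgebra.spectralOrderedRing A
  obtain ⟨x, hx, -, rfl⟩ := CStarAlgebra.exists_sum_four_nonneg a
  refine Submodule.sum_mem _ fun i _ => Submodule.smul_mem _ _ (Submodule.subset_span ?_)
  obtain ⟨b, hb⟩ := CStarAlgebra.nonneg_iff_eq_star_mul_self.mp (hx i)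
  exact ⟨_, _, hb⟩

/-- The class of `b * c` is `π(b)` applied to the class of `c`. As products span `A`, the whole
dense pre-GNS space lies in the span of the vectors `π(b)k`. -/
theorem isNondegenerate_gns {A : Type u} [NonUnitalCStarAlgebra A] [PartialOrder A]
    [StarOrderedRing A] (f : A →ₚ[ℂ] ℂ) : IsNondegenerate f.gnsNonUnitalStarAlgHom := by
  refine (UniformSpace.Completion.denseRange_coe (α := f.PreGNS)).mono ?_
  rintro _ ⟨x, rfl⟩
  have h := mem_span_mul (f.ofPreGNS x)
  have key : ∀ a ∈ Submodule.span ℂ {x : A | ∃ b c, x = b * c},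
      ((f.toPreGNS a : f.PreGNS) : f.GNS) ∈
        Submodule.span ℂ {h : f.GNS | ∃ b k, h = f.gnsNonUnitalStarAlgHom b k} := by
    intro a ha
    induction ha using Submodule.span_induction with
    | mem a ha =>
      obtain ⟨b, c, rfl⟩ := ha
      refine Submodule.subset_span ⟨b, (f.toPreGNS c : f.PreGNS), ?_⟩
      simp
    | zero =>
      rw [map_zero, UniformSpace.Completion.coe_zero]
      exact Submodule.zero_mem _
    | add a b _ _ ha hb =>
      rw [map_add, UniformSpace.Completion.coe_add]
      exact Submodule.add_mem _ ha hb
    | smul z a _ ha =>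
      rw [map_smul, UniformSpace.Completion.coe_smul]
      exact Submodule.smul_mem _ z ha
  exact key _ h

/-- Without a unit there is no evident cyclic vector, so `π(a)` is tested on the class of `star a`,
where the squared norm is `f (star (a * star a) * (a * star a))`. The argument of `f` is positive
and, by the C*-identity, nonzero. -/
theorem exists_gns_apply_ne_zero {A : Type u} [NonUnitalCStarAlgebra A] [PartialOrder A]
    [StarOrderedRing A] {a : A} (ha : a ≠ 0) :
    ∃ f : A →ₚ[ℂ] ℂ, f.gnsNonUnitalStarAlgHom a ≠ 0 := by
  have h1 : star (a * star a) * (a * star a) ≠ 0 := by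
    rw [Ne, CStarRing.star_mul_self_eq_zero_iff, CStarRing.mul_star_self_eq_zero_iff]
    exact ha
  obtain ⟨f, hf⟩ := exists_positive_apply_ne_zero (star_mul_self_nonneg _) h1
  refine ⟨f, fun h => hf ?_⟩
  have h2 : f.gnsNonUnitalStarAlgHom a ((f.toPreGNS (star a) : f.PreGNS) : f.GNS) = 0 := by
    rw [h]; rfl
  rw [PositiveLinearMap.gnsNonUnitalStarAlgHom_apply_coe, ← norm_eq_zero,
    UniformSpace.Completion.norm_coe] at h2
  have h3 := f.preGNS_norm_sq (f.leftMulMapPreGNS a (f.toPreGNS (star a)))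
  rw [h2] at h3
  simpa using h3.symm

end FaithfulRepresentation

/-! ### Hilbert sums of representations -/

section DirectSum

variable {ι : Type v} {H : ι → Type w} [∀ i, NormedAddCommGroup (H i)]
  [∀ i, InnerProductSpace ℂ (H i)]

/-- The block-diagonal operator on a Hilbert sum given by a bounded family of operators. -/
def diagOp (T : ∀ i, H i →L[ℂ] H i) (C : ℝ) (hT : ∀ i, ‖T i‖ ≤ C) : lp H 2 →L[ℂ] lp H 2 :=
  -- Domination by `C • ξ` in each coordinate gives both square-summability and the operator bound.
  have hle : ∀ (ξ : lp H 2) i, ‖T i (ξ i)‖ ≤ ‖((C : ℂ) • ξ : lp H 2) i‖ := fun ξ i => by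
    have hC : 0 ≤ C := (norm_nonneg _).trans (hT i)
    rw [lp.coeFn_smul, Pi.smul_apply, norm_smul, Complex.norm_real, Real.norm_of_nonneg hC]
    exact (T i).le_of_opNorm_le (hT i) _
  LinearMap.mkContinuous
    { toFun := fun ξ => ⟨fun i => T i (ξ i), (lp.memℓp ((C : ℂ) • ξ)).mono' (hle ξ)⟩
      map_add' := fun ξ η => by ext i; exact map_add (T i) (ξ i) (η i)
      map_smul' := fun c ξ => by ext i; simp }
    ‖(C : ℂ)‖ fun ξ => by
      rw [← norm_smul]
      exact lp.norm_mono two_ne_zero (hle ξ)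

theorem diagOp_apply (T : ∀ i, H i →L[ℂ] H i) (C : ℝ) (hT : ∀ i, ‖T i‖ ≤ C) (ξ : lp H 2) (i : ι) :
    diagOp T C hT ξ i = T i (ξ i) := rfl

/-- A subspace of a Hilbert sum whose closure contains all vectors supported at one index is dense. -/
theorem dense_of_single_mem [DecidableEq ι] (S : Submodule ℂ (lp H 2))
    (h : ∀ i (k : H i), lp.single 2 i k ∈ S.topologicalClosure) : Dense (S : Set (lp H 2)) := by
  intro ξ
  change ξ ∈ (S.topologicalClosure : Set (lp H 2))
  have hs := lp.hasSum_single (p := 2) (by simp) ξ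
  exact S.isClosed_topologicalClosure.mem_of_tendsto hs
    (Filter.Eventually.of_forall fun s => Submodule.sum_mem _ fun i _ => h i _)

variable [∀ i, CompleteSpace (H i)]

/-- The direct sum of a family of representations. -/
def directSumRep {B : Type u} [NonUnitalCStarAlgebra B] (φ : ∀ i, B →⋆ₙₐ[ℂ] (H i →L[ℂ] H i)) :
    B →⋆ₙₐ[ℂ] (lp H 2 →L[ℂ] lp H 2) where
  toFun b := diagOp (fun i => φ i b) ‖b‖ fun i => NonUnitalStarAlgHom.norm_apply_le (φ i) b
  map_smul' c b := by ext ξ i; simp [diagOp_apply]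
  map_zero' := by ext ξ i; simp [diagOp_apply]
  map_add' b c := by ext ξ i; simp [diagOp_apply]
  map_mul' b c := by ext ξ i; simp [diagOp_apply]
  map_star' b := by
    rw [ContinuousLinearMap.star_eq_adjoint, ContinuousLinearMap.eq_adjoint_iff]
    intro ξ η
    rw [lp.inner_eq_tsum, lp.inner_eq_tsum]
    refine tsum_congr fun i => ?_
    rw [diagOp_apply, diagOp_apply, map_star, ContinuousLinearMap.star_eq_adjoint,
      ContinuousLinearMap.adjoint_inner_left]

variable {B : Type u} [NonUnitalCStarAlgebra B] (φ : ∀ i, B →⋆ₙₐ[ℂ] (H i →L[ℂ] H i))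

theorem directSumRep_apply (b : B) (ξ : lp H 2) (i : ι) :
    directSumRep φ b ξ i = φ i b (ξ i) := rfl

theorem directSumRep_single [DecidableEq ι] (b : B) (i : ι) (h : H i) :
    directSumRep φ b (lp.single 2 i h) = lp.single 2 i (φ i b h) := by
  ext j
  rw [directSumRep_apply, lp.single_apply, lp.single_apply]
  by_cases hj : j = i
  · subst hj; simp
  · simp [hj]

theorem injective_directSumRep (h : ∀ b, b ≠ 0 → ∃ i, φ i b ≠ 0) :
    Function.Injective (directSumRep φ) := by
  classical
  rw [injective_iff_map_eq_zero]
  intro b hb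
  by_contra hb0
  obtain ⟨i, hi⟩ := h b hb0
  refine hi (ContinuousLinearMap.ext fun k => ?_)
  have := directSumRep_single φ b i k
  rw [hb] at this
  have h2 := congrArg (fun ξ : lp H 2 => ξ i) this
  simpa using h2.symm

theorem isNondegenerate_directSumRep (h : ∀ i, IsNondegenerate (φ i)) :
    IsNondegenerate (directSumRep φ) := by
  classical
  refine dense_of_single_mem _ fun i k => ?_
  set S := Submodule.span ℂ {h : lp H 2 | ∃ b k, h = directSumRep φ b k}
  have hcl : IsClosed {k : H i | lp.single 2 i k ∈ S.topologicalClosure} :=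
    S.isClosed_topologicalClosure.preimage (lp.isometry_single (E := H) (p := 2) i).continuous
  refine hcl.closure_subset_iff.mpr ?_ (h i k)
  intro k hk
  refine S.le_topologicalClosure ?_
  change k ∈ S.comap (lp.lsingle (𝕜 := ℂ) (E := H) 2 i)
  refine Submodule.span_le.mpr ?_ hk
  rintro _ ⟨b, k, rfl⟩
  exact Submodule.subset_span ⟨b, lp.single 2 i k, (directSumRep_single φ b i k).symm⟩

end DirectSum

/-- Every C*-algebra has a faithful nondegenerate representation. -/
theorem exists_faithful_rep (A : Type u) [NonUnitalCStarAlgebra A] :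
    ∃ (H : Type u) (_ : NormedAddCommGroup H) (_ : InnerProductSpace ℂ H) (_ : CompleteSpace H)
      (π : A →⋆ₙₐ[ℂ] (H →L[ℂ] H)), Function.Injective π ∧ IsNondegenerate π := by
  let _ := CStarAlgebra.spectralOrder A
  have := CStarAlgebra.spectralOrderedRing A
  -- One GNS representation for each nonzero element; this index set keeps the Hilbert space in the
  -- universe of `A`, as `regularCovariantRep` requires.
  choose f hf using fun a : {a : A // a ≠ 0} => exists_gns_apply_ne_zero a.2
  refine ⟨lp (fun a => (f a).GNS) 2, inferInstance, inferInstance, inferInstance,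
    directSumRep fun a => (f a).gnsNonUnitalStarAlgHom, ?_, ?_⟩
  · exact injective_directSumRep _ fun b hb => ⟨⟨b, hb⟩, hf ⟨b, hb⟩⟩
  · exact isNondegenerate_directSumRep _ fun a => isNondegenerate_gns (f a)

/-- A *-homomorphism of C*-algebras as a bounded linear map. -/
def starHomL {A : Type u} {D : Type v} [NonUnitalCStarAlgebra A] [NonUnitalCStarAlgebra D]
    (φ : A →⋆ₙₐ[ℂ] D) : A →L[ℂ] D :=
  LinearMap.mkContinuous
    { toFun := φ
      map_add' := map_add φ
      map_smul' := map_smul φ } 1 fun a => by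
    rw [one_mul]
    exact NonUnitalStarAlgHom.norm_apply_le φ a

theorem starHomL_apply {A : Type u} {D : Type v} [NonUnitalCStarAlgebra A]
    [NonUnitalCStarAlgebra D] (φ : A →⋆ₙₐ[ℂ] D) (a : A) : starHomL φ a = φ a := rfl

@[fun_prop]
theorem continuous_starHom {A : Type u} {D : Type v} [NonUnitalCStarAlgebra A]
    [NonUnitalCStarAlgebra D] (φ : A →⋆ₙₐ[ℂ] D) : Continuous φ := (starHomL φ).continuous

/-! ### Density of elementary tensors and commuting pairs of homomorphisms -/

section Density

variable {G : Type v} [Group G] {A : Type u} {B : Type w} [NonUnitalCStarAlgebra A]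
  [NonUnitalCStarAlgebra B]

/-- The elements `s ∈ G` span a dense subspace of `C*(G)`. -/
theorem dense_span_groupU :
    Dense (Submodule.span ℂ (Set.range (groupU (G := G))) : Set (GroupCStar G)) := by
  refine (groupNorm G).denseRange_toCompl.mono ?_
  rintro _ ⟨x, rfl⟩
  change (groupNorm G).toCompl x ∈ (Submodule.span ℂ (Set.range (groupU (G := G))) :
    Submodule ℂ (groupNorm G).Compl)
  induction x using MonoidAlgebra.induction_linear with
  | zero =>
    rw [map_zero]
    exact Submodule.zero_mem _
  | add x y hx hy =>
    rw [map_add]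
    exact Submodule.add_mem _ hx hy
  | single s c =>
    have h : MonoidAlgebra.single s c = c • MonoidAlgebra.single s (1 : ℂ) := by simp
    rw [h, map_smul]
    exact Submodule.smul_mem _ c (Submodule.subset_span ⟨s, rfl⟩)

/-- The elementary tensor as a bounded bilinear map. -/
def MaxTensor.tmulL : A →L[ℂ] B →L[ℂ] MaxTensor A B :=
  MaxTensor.tmulₗ.mkContinuous₂ 1 fun a b => by
    rw [one_mul]
    exact MaxTensor.norm_tmul_le a b

theorem MaxTensor.tmulL_apply (a : A) (b : B) : MaxTensor.tmulL a b = MaxTensor.tmul a b := rfl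

theorem MaxTensor.tmul_add (a : A) (b c : B) : MaxTensor.tmul a (b + c) =
    MaxTensor.tmul a b + MaxTensor.tmul a c := map_add (MaxTensor.tmulₗ a) b c

theorem MaxTensor.tmul_zero (a : A) : MaxTensor.tmul a (0 : B) = 0 :=
  map_zero (MaxTensor.tmulₗ a)

theorem MaxTensor.add_tmul (a b : A) (c : B) : MaxTensor.tmul (a + b) c =
    MaxTensor.tmul a c + MaxTensor.tmul b c := LinearMap.map_add₂ MaxTensor.tmulₗ a b c

theorem MaxTensor.zero_tmul (c : B) : MaxTensor.tmul (0 : A) c = 0 :=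
  LinearMap.map_zero₂ MaxTensor.tmulₗ c

theorem MaxTensor.smul_tmul (z : ℂ) (a : A) (c : B) : MaxTensor.tmul (z • a) c =
    z • MaxTensor.tmul a c := LinearMap.map_smul₂ MaxTensor.tmulₗ z a c

theorem MaxTensor.tmul_smul (z : ℂ) (a : A) (c : B) : MaxTensor.tmul a (z • c) =
    z • MaxTensor.tmul a c := map_smul (MaxTensor.tmulₗ a) z c

@[fun_prop]
theorem MaxTensor.continuous_tmul_left (c : B) : Continuous fun a : A => MaxTensor.tmul a c :=
  (MaxTensor.tmulL (A := A).flip c).continuous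

@[fun_prop]
theorem MaxTensor.continuous_tmul_right (a : A) : Continuous fun c : B => MaxTensor.tmul a c :=
  (MaxTensor.tmulL a).continuous

@[elab_as_elim]
theorem MaxTensor.induction_tmul {P : MaxTensor A B → Prop} (y : MaxTensor A B)
    (hc : IsClosed {y | P y}) (zero : P 0) (add : ∀ x y, P x → P y → P (x + y))
    (tmul : ∀ a b, P (MaxTensor.tmul a b)) : P y := by
  refine MaxTensor.induction_on y hc fun x => ?_
  induction x using TensorProduct.induction_on with
  | zero => rwa [map_zero]
  | add x y hx hy =>
    rw [map_add]
    exact add _ _ hx hy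
  | tmul a b => exact tmul a b

-- The group elements span a dense subspace of `C*(G)`. Scalars in the second factor are absorbed
-- into `a`, so closure under sums suffices; for this the span induction must generalize `a`.
@[elab_as_elim]
theorem MaxTensor.induction_groupU {P : MaxTensor A (GroupCStar G) → Prop}
    (y : MaxTensor A (GroupCStar G))
    (hc : IsClosed {y | P y}) (zero : P 0) (add : ∀ x y, P x → P y → P (x + y))
    (tmul : ∀ a s, P (MaxTensor.tmul a (groupU s))) : P y := by
  refine MaxTensor.induction_tmul y hc zero add fun a b => ?_
  have hcl : IsClosed {b : GroupCStar G | P (MaxTensor.tmul a b)} :=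
    hc.preimage (MaxTensor.continuous_tmul_right a)
  refine hcl.closure_subset_iff.mpr ?_ (dense_span_groupU b)
  intro b hb
  rw [SetLike.mem_coe] at hb
  induction hb using Submodule.span_induction generalizing a with
  | mem b hb =>
    obtain ⟨s, rfl⟩ := hb
    exact tmul a s
  | zero =>
    change P (MaxTensor.tmul a 0)
    rwa [MaxTensor.tmul_zero]
  | add b c _ _ hb hc' =>
    change P (MaxTensor.tmul a (b + c))
    rw [MaxTensor.tmul_add]
    exact add _ _ (hb a (hc.preimage (MaxTensor.continuous_tmul_right a)))
      (hc' a (hc.preimage (MaxTensor.continuous_tmul_right a)))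
  | smul z b _ hb =>
    change P (MaxTensor.tmul a (z • b))
    rw [MaxTensor.tmul_smul, ← MaxTensor.smul_tmul]
    exact hb (z • a) (hc.preimage (MaxTensor.continuous_tmul_right _))

/-- The identities between slices, counit and `diagonal` used for the density theorem are all
checked on tensors `a ⊗ s` through this lemma. -/
theorem MaxTensor.ext_groupU {E : Type*} [AddCommGroup E] [TopologicalSpace E] [T2Space E]
    {F F' : Type*} [FunLike F (MaxTensor A (GroupCStar G)) E]
    [AddMonoidHomClass F (MaxTensor A (GroupCStar G)) E]
    [FunLike F' (MaxTensor A (GroupCStar G)) E]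
    [AddMonoidHomClass F' (MaxTensor A (GroupCStar G)) E] (f : F) (g : F')
    (hf : Continuous f) (hg : Continuous g)
    (h : ∀ a s, f (MaxTensor.tmul a (groupU s)) = g (MaxTensor.tmul a (groupU s)))
    (y : MaxTensor A (GroupCStar G)) : f y = g y :=
  MaxTensor.induction_groupU y (isClosed_eq hf hg) (by rw [map_zero, map_zero])
    (fun x y hx hy => by rw [map_add, map_add, hx, hy]) h

/-- The *-homomorphism `a ⊗ b ↦ φ(a) ψ(b)` given by two *-homomorphisms with commuting ranges. -/
def MaxTensor.commLift {D : Type*} [NonUnitalCStarAlgebra D] (φ : A →⋆ₙₐ[ℂ] D) (ψ : B →⋆ₙₐ[ℂ] D)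
    (h : ∀ a b, Commute (φ a) (ψ b)) : MaxTensor A B →⋆ₙₐ[ℂ] D :=
  MaxTensor.lift ((LinearMap.mul ℂ D).compl₁₂ (φ : A →ₗ[ℂ] D) (ψ : B →ₗ[ℂ] D))
    (fun a a' b b' => by
      change φ a * ψ b * (φ a' * ψ b') = φ (a * a') * ψ (b * b')
      rw [map_mul, map_mul, mul_assoc, mul_assoc, ← mul_assoc (ψ b), ← (h a' b).eq, mul_assoc])
    (fun a b => by
      change star (φ a * ψ b) = φ (star a) * ψ (star b)
      rw [star_mul, ← map_star, ← map_star, (h _ _).eq])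
    (fun a b => (norm_mul_le (φ a) (ψ b)).trans
      (mul_le_mul (NonUnitalStarAlgHom.norm_apply_le φ a) (NonUnitalStarAlgHom.norm_apply_le ψ b)
        (norm_nonneg _) (norm_nonneg _)))

theorem MaxTensor.commLift_tmul {D : Type*} [NonUnitalCStarAlgebra D] (φ : A →⋆ₙₐ[ℂ] D)
    (ψ : B →⋆ₙₐ[ℂ] D) (h : ∀ a b, Commute (φ a) (ψ b)) (a : A) (b : B) :
    MaxTensor.commLift φ ψ h (MaxTensor.tmul a b) = φ a * ψ b :=
  MaxTensor.lift_tmul _ _ _ _ a b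

/-- An element commuting with the images of all `s ∈ G` commutes with the image of `C*(G)`. -/
theorem commute_of_commute_groupU {D : Type*} [NonUnitalCStarAlgebra D]
    (ψ : GroupCStar G →⋆ₙₐ[ℂ] D) (d : D) (h : ∀ s, Commute d (ψ (groupU s))) (x : GroupCStar G) :
    Commute d (ψ x) := by
  have hcont : Continuous ψ := continuous_starHom ψ
  have hcl : IsClosed {x | Commute d (ψ x)} := isClosed_eq (by fun_prop) (by fun_prop)
  refine hcl.closure_subset_iff.mpr ?_ (dense_span_groupU x)
  intro x hx
  rw [SetLike.mem_coe] at hx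
  induction hx using Submodule.span_induction with
  | mem x hx =>
    obtain ⟨s, rfl⟩ := hx
    exact h s
  | zero =>
    change Commute d (ψ 0)
    rw [map_zero]
    exact Commute.zero_right d
  | add x y _ _ hx hy =>
    change Commute d (ψ (x + y))
    rw [map_add]
    exact Commute.add_right hx hy
  | smul z x _ hx =>
    change Commute d (ψ (z • x))
    rw [map_smul]
    exact Commute.smul_right hx z

end Density

/-! ### Translations on `ℓ²(G, H)` -/

section Translation

variable {ι : Type v} {H : Type w} [NormedAddCommGroup H] [InnerProductSpace ℂ H]

/-- The operator on `ℓ²(ι, H)` that permutes the coordinates. -/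
def permOp (H : Type w) [NormedAddCommGroup H] [InnerProductSpace ℂ H] (e : Equiv.Perm ι) :
    lp (fun _ : ι => H) 2 →L[ℂ] lp (fun _ : ι => H) 2 :=
  have h2 : 0 < (2 : ℝ≥0∞).toReal := by simp
  LinearMap.mkContinuous
    { toFun := fun ξ => ⟨fun i => ξ (e.symm i), memℓp_gen
        ((e.symm.summable_iff (f := fun i => ‖ξ i‖ ^ (2 : ℝ≥0∞).toReal)).mpr
          ((lp.memℓp ξ).summable h2))⟩
      map_add' := fun ξ η => by ext i; rfl
      map_smul' := fun c ξ => by ext i; rfl }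
    1 fun ξ => by
      rw [one_mul]
      refine lp.norm_le_of_tsum_le h2 (norm_nonneg _) ?_
      rw [lp.norm_rpow_eq_tsum h2]
      exact (e.symm.tsum_eq (fun i => ‖ξ i‖ ^ (2 : ℝ≥0∞).toReal)).le

theorem permOp_apply (e : Equiv.Perm ι) (ξ : lp (fun _ : ι => H) 2) (i : ι) :
    permOp H e ξ i = ξ (e.symm i) := rfl

theorem permOp_single [DecidableEq ι] (e : Equiv.Perm ι) (i : ι) (h : H) :
    permOp H e (lp.single (E := fun _ : ι => H) 2 i h) = lp.single 2 (e i) h := by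
  ext j
  rw [permOp_apply, lp.single_apply, lp.single_apply]
  simp only [Pi.single_apply, Equiv.symm_apply_eq]

/-- The matrix coefficient `T ↦ T_{s,1}` of operators on `ℓ²(G, H)`. -/
def coeffL (H : Type w) [NormedAddCommGroup H] [InnerProductSpace ℂ H]
    {G : Type v} [Group G] [DecidableEq G] (s : G) :
    (lp (fun _ : G => H) 2 →L[ℂ] lp (fun _ : G => H) 2) →L[ℂ] (H →L[ℂ] H) :=
  (ContinuousLinearMap.compL ℂ H (lp (fun _ : G => H) 2) H
      (lp.evalCLM ℂ (fun _ : G => H) 2 s)).comp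
    ((ContinuousLinearMap.compL ℂ H (lp (fun _ : G => H) 2) (lp (fun _ : G => H) 2)).flip
      (lp.singleContinuousLinearMap ℂ (fun _ : G => H) 2 1))

theorem coeffL_apply {G : Type v} [Group G] [DecidableEq G] (s : G)
    (T : lp (fun _ : G => H) 2 →L[ℂ] lp (fun _ : G => H) 2) (h : H) :
    coeffL H s T h = T (lp.single (E := fun _ : G => H) 2 1 h) s := rfl

variable [CompleteSpace H]

/-- The representation of `C*(G)` on `ℓ²(ι, H)` given by an action of `G` on `ι`. -/
def permRep {G : Type u} [Group G] (H : Type w) [NormedAddCommGroup H] [InnerProductSpace ℂ H]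
    [CompleteSpace H] (θ : G →* Equiv.Perm ι) :
    GroupCStar G →⋆ₙₐ[ℂ] (lp (fun _ : ι => H) 2 →L[ℂ] lp (fun _ : ι => H) 2) :=
  groupLift
    { toFun := fun s => permOp H (θ s)
      map_mul' := fun s t => by
        rw [map_mul]
        rfl }
    fun s => by
      change permOp H (θ s⁻¹) = star (permOp H (θ s))
      rw [ContinuousLinearMap.star_eq_adjoint, ContinuousLinearMap.eq_adjoint_iff]
      intro ξ η
      rw [lp.inner_eq_tsum, lp.inner_eq_tsum, ← (θ s).symm.tsum_eq]
      refine tsum_congr fun i => ?_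
      have hi : (θ s⁻¹).symm ((θ s).symm i) = i := by
        rw [map_inv]
        exact (θ s).apply_symm_apply i
      rw [permOp_apply, permOp_apply, hi]

theorem permRep_groupU {G : Type u} [Group G] (θ : G →* Equiv.Perm ι) (s : G) :
    permRep H θ (groupU s) = permOp H (θ s) := groupLift_groupU _ _ s

/-- The amplification of a representation on `H` to `ℓ²(ι, H)`. -/
def amplify {A : Type u} [NonUnitalCStarAlgebra A] (ι : Type v) (π : A →⋆ₙₐ[ℂ] (H →L[ℂ] H)) :
    A →⋆ₙₐ[ℂ] (lp (fun _ : ι => H) 2 →L[ℂ] lp (fun _ : ι => H) 2) :=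
  directSumRep fun _ : ι => π

theorem commute_amplify_permOp {A : Type u} [NonUnitalCStarAlgebra A]
    (π : A →⋆ₙₐ[ℂ] (H →L[ℂ] H)) (a : A) (e : Equiv.Perm ι) :
    Commute (amplify ι π a) (permOp H e) := by
  ext ξ i
  rfl

/-- Right translation, as a left action. -/
def rightPerm (G : Type v) [Group G] : G →* Equiv.Perm G where
  toFun s := Equiv.mulRight s⁻¹
  map_one' := by ext; simp
  map_mul' s t := by ext; simp [mul_assoc]

variable {G : Type v} [Group G] {A : Type u} [NonUnitalCStarAlgebra A]
  (π : A →⋆ₙₐ[ℂ] (H →L[ℂ] H))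

/-- The representation `π ⊗ λ` of `A ⊗ C*(G)` on `ℓ²(G, H)`. -/
def regularRep : MaxTensor A (GroupCStar G) →⋆ₙₐ[ℂ]
    (lp (fun _ : G => H) 2 →L[ℂ] lp (fun _ : G => H) 2) :=
  MaxTensor.commLift (amplify G π) (permRep H (MulAction.toPermHom G G)) fun a =>
    commute_of_commute_groupU _ _ fun s => by
      rw [permRep_groupU]
      exact commute_amplify_permOp π a _

theorem regularRep_tmul (a : A) (s : G) : regularRep π (MaxTensor.tmul a (groupU s)) =
    amplify G π a * permOp H (MulAction.toPermHom G G s) := by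
  rw [regularRep, MaxTensor.commLift_tmul, permRep_groupU]

theorem regularRep_tmul_single [DecidableEq G] (a : A) (s t : G) (h : H) :
    regularRep π (MaxTensor.tmul a (groupU s)) (lp.single (E := fun _ : G => H) 2 t h) =
      lp.single 2 (s * t) (π a h) := by
  rw [regularRep_tmul, mul_apply_eq_comp, permOp_single, amplify,
    directSumRep_single]
  rfl

/-- Left and right translations commute, and `π` acts coordinatewise. This is what allows `π`, `λ`
and the right regular representation to be combined in `biregularRep`. -/
theorem commute_regularRep (y : MaxTensor A (GroupCStar G)) (t : G) :
    Commute (regularRep π y) (permOp H (rightPerm G t)) := by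
  have hcont : Continuous (regularRep π (G := G)) := continuous_starHom _
  refine MaxTensor.induction_groupU y (isClosed_eq (by fun_prop) (by fun_prop)) ?_ ?_ ?_
  · rw [map_zero]
    exact Commute.zero_left _
  · intro x y hx hy
    rw [map_add]
    exact Commute.add_left hx hy
  · intro a s
    rw [regularRep_tmul]
    refine (commute_amplify_permOp π a _).mul_left ?_
    ext ξ i
    change ξ (_ : G) = ξ (_ : G)
    simp [rightPerm, mul_assoc]

/-- The representation of `(A ⊗ C*(G)) ⊗ C*(G)` on `ℓ²(G, H)` given by `π` and the left and right
regular representations. -/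
def biregularRep : MaxTensor (MaxTensor A (GroupCStar G)) (GroupCStar G) →⋆ₙₐ[ℂ]
    (lp (fun _ : G => H) 2 →L[ℂ] lp (fun _ : G => H) 2) :=
  MaxTensor.commLift (regularRep π) (permRep H (rightPerm G)) fun y =>
    commute_of_commute_groupU _ _ fun s => by
      rw [permRep_groupU]
      exact commute_regularRep π y s

theorem biregularRep_tmul_single [DecidableEq G] (a : A) (s t r : G) (h : H) :
    biregularRep π (MaxTensor.tmul (MaxTensor.tmul a (groupU s)) (groupU t))
      (lp.single (E := fun _ : G => H) 2 r h) = lp.single 2 (s * (r * t⁻¹)) (π a h) := by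
  rw [biregularRep, MaxTensor.commLift_tmul, permRep_groupU, mul_apply_eq_comp,
    permOp_single, regularRep_tmul_single]
  rfl

end Translation

/-! ### Slice maps -/

section Slice

/-- A bounded map whose values lie in the range of a faithful representation factors through it. -/
theorem exists_factor_of_mem_range {A : Type u} [NonUnitalCStarAlgebra A] {D : Type w}
    [NonUnitalCStarAlgebra D] {π : A →⋆ₙₐ[ℂ] D} (hπ : Function.Injective π) {X : Type v}
    [NormedAddCommGroup X] [NormedSpace ℂ X] (S : X →L[ℂ] D) (hS : ∀ x, S x ∈ Set.range π) :
    ∃ E : X →L[ℂ] A, ∀ x, π (E x) = S x := by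
  choose E hE using hS
  refine ⟨LinearMap.mkContinuous
    { toFun := E
      map_add' := fun x y => hπ (by rw [map_add, hE, hE, hE, map_add])
      map_smul' := fun c x => hπ (by rw [RingHom.id_apply, map_smul, hE, hE, map_smul]) }
    ‖S‖ fun x => ?_, hE⟩
  change ‖E x‖ ≤ _
  -- An injective *-homomorphism is isometric, so the bound on `S` passes to `E`.
  rw [← NonUnitalStarAlgHom.norm_map π hπ, hE]
  exact S.le_opNorm x

theorem isClosed_range_of_injective {A : Type u} [NonUnitalCStarAlgebra A] {D : Type w}
    [NonUnitalCStarAlgebra D] {π : A →⋆ₙₐ[ℂ] D} (hπ : Function.Injective π) :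
    IsClosed (Set.range π) :=
  (NonUnitalStarAlgHom.isometry π hπ).isClosedEmbedding.isClosed_range

variable {G : Type v} [Group G] (A : Type u) [NonUnitalCStarAlgebra A]

/-- The slice map `A ⊗ C*(G) → A` by the coefficient functional at `s`. -/
theorem exists_slice [DecidableEq G] (s : G) : ∃ E : MaxTensor A (GroupCStar G) →L[ℂ] A,
    ∀ a t, E (MaxTensor.tmul a (groupU t)) = if t = s then a else 0 := by
  obtain ⟨H, _, _, _, π, hπ, -⟩ := exists_faithful_rep A
  -- `λ(t)` moves `e_1` to `e_t`, so the `(s, 1)` matrix entry of `π(a) λ(t)` is `π(a)` if `t = s`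
  -- and `0` otherwise.
  let S : MaxTensor A (GroupCStar G) →L[ℂ] (H →L[ℂ] H) :=
    (coeffL H s).comp (starHomL (regularRep π))
  have hS : ∀ a t, S (MaxTensor.tmul a (groupU t)) = π (if t = s then a else 0) := fun a t => by
    ext h
    change coeffL H s (regularRep π _) h = _
    rw [coeffL_apply, regularRep_tmul_single, mul_one, lp.single_apply, Pi.single_apply]
    by_cases hst : s = t
    · simp [hst]
    · simp [hst, Ne.symm hst]
  obtain ⟨E, hE⟩ := exists_factor_of_mem_range hπ S fun y => by
    refine MaxTensor.induction_groupU y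
      ((isClosed_range_of_injective hπ).preimage S.continuous) ⟨0, by simp⟩ ?_ ?_
    · rintro x y ⟨a, ha⟩ ⟨b, hb⟩
      exact ⟨a + b, by rw [map_add, map_add, ha, hb]⟩
    · exact fun a t => ⟨_, (hS a t).symm⟩
  exact ⟨E, fun a t => hπ ((hE _).trans (hS a t))⟩

/-- The slice map `(A ⊗ C*(G)) ⊗ C*(G) → A` by the functional `s ⊗ t ↦ δ_{s,t}`. -/
theorem exists_diagonal_slice [DecidableEq G] :
    ∃ E : MaxTensor (MaxTensor A (GroupCStar G)) (GroupCStar G) →L[ℂ] A,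
      ∀ a s t, E (MaxTensor.tmul (MaxTensor.tmul a (groupU s)) (groupU t)) =
        if s = t then a else 0 := by
  obtain ⟨H, _, _, _, π, hπ, -⟩ := exists_faithful_rep A
  -- Left translation by `s` and right translation by `t` together move `e_1` to `e_{s t⁻¹}`, so the
  -- `(1, 1)` entry detects `s = t`.
  let S : MaxTensor (MaxTensor A (GroupCStar G)) (GroupCStar G) →L[ℂ] (H →L[ℂ] H) :=
    (coeffL H (1 : G)).comp (starHomL (biregularRep π))
  have hS : ∀ a s t, S (MaxTensor.tmul (MaxTensor.tmul a (groupU s)) (groupU t)) =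
      π (if s = t then a else 0) := fun a s t => by
    ext h
    change coeffL H (1 : G) (biregularRep π _) h = _
    rw [coeffL_apply, biregularRep_tmul_single, one_mul, lp.single_apply, Pi.single_apply]
    by_cases hst : s = t
    · simp [hst]
    · have : ¬ 1 = s * t⁻¹ := fun h => hst (mul_inv_eq_one.mp h.symm)
      simp [hst, this]
  have hadd : ∀ x y, S x ∈ Set.range π → S y ∈ Set.range π → S (x + y) ∈ Set.range π := by
    rintro x y ⟨a, ha⟩ ⟨b, hb⟩
    exact ⟨a + b, by rw [map_add, map_add, ha, hb]⟩
  have hcl := (isClosed_range_of_injective hπ).preimage S.continuous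
  obtain ⟨E, hE⟩ := exists_factor_of_mem_range hπ S fun z => by
    refine MaxTensor.induction_groupU z hcl ⟨0, by simp⟩ hadd fun y t => ?_
    refine MaxTensor.induction_groupU y (hcl.preimage (MaxTensor.continuous_tmul_left _)) ?_ ?_ ?_
    · rw [MaxTensor.zero_tmul]
      exact ⟨0, by simp⟩
    · intro x y hx hy
      rw [MaxTensor.add_tmul]
      exact hadd _ _ hx hy
    · exact fun a s => ⟨_, (hS a s t).symm⟩
  exact ⟨E, fun a s t => hπ ((hE _).trans (hS a s t))⟩

/-- The *-homomorphism `A ⊗ C*(G) → A` given by the trivial representation of `G`. -/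
theorem exists_counit_slice (G : Type v) [Group G] (A : Type u) [NonUnitalCStarAlgebra A] :
    ∃ ε : MaxTensor A (GroupCStar G) →⋆ₙₐ[ℂ] A, ∀ a s, ε (MaxTensor.tmul a (groupU s)) = a := by
  let τ : GroupCStar G →⋆ₙₐ[ℂ] ℂ := groupLift
    { toFun := fun _ => 1
      map_mul' := fun _ _ => (mul_one 1).symm } fun _ => (star_one ℂ).symm
  refine ⟨MaxTensor.lift ((LinearMap.lsmul ℂ A).flip.compl₂ (starHomL τ).toLinearMap) ?_ ?_ ?_,
    fun a s => ?_⟩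
  · intro a a' x x'
    change (τ x • a) * (τ x' • a') = τ (x * x') • (a * a')
    rw [map_mul, smul_mul_smul_comm]
  · intro a x
    change star (τ x • a) = τ (star x) • star a
    rw [star_smul, map_star]
  · intro a x
    change ‖τ x • a‖ ≤ _
    rw [norm_smul, mul_comm]
    exact mul_le_mul_of_nonneg_left (NonUnitalStarAlgHom.norm_apply_le τ x) (norm_nonneg a)
  · rw [MaxTensor.lift_tmul]
    change τ (groupU s) • a = a
    have : τ (groupU s) = 1 := groupLift_groupU _ _ s
    rw [this, one_smul]

end Slice

/-! ### The inverse of the associator -/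

namespace MaxTensor

section AssocInv

variable {A : Type u} {B : Type v} {C : Type w} [NonUnitalCStarAlgebra A]
  [NonUnitalCStarAlgebra B] [NonUnitalCStarAlgebra C]

/-- The linear map sending `b ⊗ c` to the bounded operator `a ↦ (a ⊗ b) ⊗ c`. -/
def rightLegₗ (A : Type u) {B : Type v} {C : Type w} [NonUnitalCStarAlgebra A]
    [NonUnitalCStarAlgebra B] [NonUnitalCStarAlgebra C] :
    B ⊗[ℂ] C →ₗ[ℂ] A →L[ℂ] MaxTensor (MaxTensor A B) C :=
  TensorProduct.lift <| LinearMap.mk₂ ℂ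
    (fun b c => ((tmulL.flip c).comp (tmulL.flip b) : A →L[ℂ] MaxTensor (MaxTensor A B) C))
    (fun b b' c => by ext a; simp)
    (fun z b c => by ext a; simp)
    (fun b c c' => by ext a; simp)
    (fun z b c => by ext a; simp)

theorem rightLegₗ_tmul (a : A) (b : B) (c : C) :
    rightLegₗ A (b ⊗ₜ[ℂ] c) a = tmul (tmul a b) c := rfl

theorem rightLegₗ_mul (a a' : A) (x y : B ⊗[ℂ] C) :
    rightLegₗ A x a * rightLegₗ A y a' = rightLegₗ A (x * y) (a * a') := by
  induction x using TensorProduct.induction_on with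
  | zero => simp
  | add x₁ x₂ h₁ h₂ =>
    simp only [add_mul, map_add, add_apply, h₁, h₂]
  | tmul b c =>
    induction y using TensorProduct.induction_on with
    | zero => simp
    | add y₁ y₂ h₁ h₂ =>
      simp only [mul_add, map_add, add_apply, h₁, h₂]
    | tmul b' c' =>
      simp only [Algebra.TensorProduct.tmul_mul_tmul, rightLegₗ_tmul, tmul_mul]

theorem star_rightLegₗ (a : A) (x : B ⊗[ℂ] C) :
    star (rightLegₗ A x a) = rightLegₗ A (star x) (star a) := by
  induction x using TensorProduct.induction_on with
  | zero => simp
  | add x y hx hy => simp only [star_add, map_add, add_apply, hx, hy]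
  | tmul b c => simp only [TensorProduct.star_tmul, rightLegₗ_tmul, star_tmul]

theorem norm_rightLegₗ_star_le (x : B ⊗[ℂ] C) :
    ‖rightLegₗ A (star x)‖ ≤ ‖rightLegₗ A x‖ := by
  refine ContinuousLinearMap.opNorm_le_bound _ (norm_nonneg _) fun a => ?_
  rw [← star_star a, ← star_rightLegₗ, norm_star, norm_star]
  exact (rightLegₗ A x).le_opNorm _

/-- Products in `B ⊙ C` do not correspond to composition of these operators. Instead `a` is the
limit of `a * u` along an approximate unit with `‖u‖ ≤ 1`, and the value at `a * u` splits as the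
value of `x` at `a` times that of `y` at `u`. -/
theorem norm_rightLegₗ_mul_le (x y : B ⊗[ℂ] C) :
    ‖rightLegₗ A (x * y)‖ ≤ ‖rightLegₗ A x‖ * ‖rightLegₗ A y‖ := by
  let _ := CStarAlgebra.spectralOrder A
  have := CStarAlgebra.spectralOrderedRing A
  have hu := CStarAlgebra.increasingApproximateUnit A
  refine ContinuousLinearMap.opNorm_le_bound _ (by positivity) fun a => ?_
  have hlim : Filter.Tendsto (fun u => ‖rightLegₗ A (x * y) (a * u)‖)
      (CStarAlgebra.approximateUnit A) (nhds ‖rightLegₗ A (x * y) a‖) :=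
    (((rightLegₗ A (x * y)).continuous.tendsto _).comp (hu.tendsto_mul_left a)).norm
  refine le_of_tendsto hlim ?_
  filter_upwards [hu.eventually_norm] with u hu1
  rw [← rightLegₗ_mul]
  calc ‖rightLegₗ A x a * rightLegₗ A y u‖ ≤ (‖rightLegₗ A x‖ * ‖a‖) * (‖rightLegₗ A y‖ * 1) :=
        (norm_mul_le _ _).trans (mul_le_mul ((rightLegₗ A x).le_opNorm a)
          ((rightLegₗ A y).le_opNorm_of_le hu1) (norm_nonneg _) (by positivity))
    _ = _ := by ring

/-- The C*-seminorm on `B ⊙ C` given by the norms of the operators `a ↦ (a ⊗ b) ⊗ c`. -/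
def rightLegSeminorm (A : Type u) (B : Type v) (C : Type w) [NonUnitalCStarAlgebra A]
    [NonUnitalCStarAlgebra B] [NonUnitalCStarAlgebra C] : CStarSeminorm (B ⊗[ℂ] C) where
  toSeminorm := (normSeminorm ℂ (A →L[ℂ] MaxTensor (MaxTensor A B) C)).comp (rightLegₗ A)
  mul_le x y := norm_rightLegₗ_mul_le x y
  star_mul_self x := by
    change ‖rightLegₗ A (star x * x)‖ = ‖rightLegₗ A x‖ * ‖rightLegₗ A x‖
    refine le_antisymm ((norm_rightLegₗ_mul_le _ _).trans
      (mul_le_mul_of_nonneg_right (norm_rightLegₗ_star_le x) (norm_nonneg _))) ?_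
    -- The C*-identity in the target gives `‖x(a)‖² = ‖(x*x)(a*a)‖ ≤ ‖x*x‖ ‖a‖²`, writing `x(a)` for
    -- `rightLegₗ A x a`.
    have h : ‖rightLegₗ A x‖ ≤ √‖rightLegₗ A (star x * x)‖ := by
      refine ContinuousLinearMap.opNorm_le_bound _ (Real.sqrt_nonneg _) fun a => ?_
      rw [← Real.sqrt_sq (norm_nonneg a), ← Real.sqrt_mul (norm_nonneg _)]
      refine Real.le_sqrt_of_sq_le ?_
      rw [sq, ← CStarRing.norm_star_mul_self, star_rightLegₗ, rightLegₗ_mul, sq,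
        ← CStarRing.norm_star_mul_self]
      exact (rightLegₗ A (star x * x)).le_opNorm _
    calc _ ≤ √‖rightLegₗ A (star x * x)‖ * √‖rightLegₗ A (star x * x)‖ :=
          mul_le_mul h h (norm_nonneg _) (Real.sqrt_nonneg _)
      _ = _ := Real.mul_self_sqrt (norm_nonneg _)

/-- The operator norm is one of the cross C*-seminorms whose supremum is the maximal norm. Hence
`rightLegₗ` extends to `B ⊗ C` although `A` may have no unit to tensor with. -/
theorem norm_rightLegₗ_le (x : B ⊗[ℂ] C) : ‖rightLegₗ A x‖ ≤ maxNorm B C x := by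
  refine CStarSeminorm.le_sup (S := crossSeminorms B C) (p := rightLegSeminorm A B C) _ _
    (fun b c => ?_) x
  refine ContinuousLinearMap.opNorm_le_bound _ (by positivity) fun a => ?_
  rw [rightLegₗ_tmul]
  calc ‖tmul (tmul a b) c‖ ≤ (‖a‖ * ‖b‖) * ‖c‖ := (norm_tmul_le _ _).trans
        (mul_le_mul_of_nonneg_right (norm_tmul_le a b) (norm_nonneg c))
    _ = _ := by ring

/-- The bounded extension of `rightLegₗ` to the maximal tensor product. -/
def rightLeg : MaxTensor B C →L[ℂ] A →L[ℂ] MaxTensor (MaxTensor A B) C :=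
  (maxNorm B C).extendL (rightLegₗ A) 1 (fun x => by
    rw [one_mul]
    exact norm_rightLegₗ_le x)

theorem rightLeg_ofAlg (x : B ⊗[ℂ] C) : rightLeg (ofAlg x) = rightLegₗ A x :=
  (maxNorm B C).extendL_toCompl _ _ _ x

theorem norm_rightLeg_apply_le (a : A) (x : MaxTensor B C) : ‖rightLeg x a‖ ≤ ‖a‖ * ‖x‖ := by
  have h : ‖(rightLeg x : A →L[ℂ] MaxTensor (MaxTensor A B) C)‖ ≤ 1 * ‖x‖ :=
    (maxNorm B C).norm_extendL_le (rightLegₗ A) 1 _ x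
  rw [one_mul] at h
  rw [mul_comm]
  exact ContinuousLinearMap.le_of_opNorm_le _ h a

theorem rightLeg_mul (a a' : A) (x y : MaxTensor B C) :
    rightLeg x a * rightLeg y a' = rightLeg (x * y) (a * a') := by
  refine induction_on x (isClosed_eq (by fun_prop) (by fun_prop)) fun x => ?_
  refine induction_on y (isClosed_eq (by fun_prop) (by fun_prop)) fun y => ?_
  rw [← ofAlg_mul, rightLeg_ofAlg, rightLeg_ofAlg, rightLeg_ofAlg, rightLegₗ_mul]

theorem star_rightLeg (a : A) (x : MaxTensor B C) :
    star (rightLeg x a) = rightLeg (star x) (star a) := by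
  refine induction_on x (isClosed_eq (by fun_prop) (by fun_prop)) fun x => ?_
  rw [← ofAlg_star, rightLeg_ofAlg, rightLeg_ofAlg, star_rightLegₗ]

/-- The canonical *-homomorphism `A ⊗ (B ⊗ C) → (A ⊗ B) ⊗ C`. -/
def assocInv : MaxTensor A (MaxTensor B C) →⋆ₙₐ[ℂ] MaxTensor (MaxTensor A B) C :=
  lift (LinearMap.mk₂ ℂ (fun a x => rightLeg x a) (fun a a' x => map_add (rightLeg x) a a')
      (fun z a x => map_smul (rightLeg x) z a)
      (fun a x y => by rw [map_add, add_apply])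
      (fun z a x => by rw [map_smul, smul_apply]))
    (fun a a' x y => rightLeg_mul a a' x y) (fun a x => star_rightLeg a x)
    (fun a x => norm_rightLeg_apply_le a x)

theorem assocInv_tmul (a : A) (b : B) (c : C) :
    assocInv (tmul a (tmul b c)) = tmul (tmul a b) c := by
  refine (lift_tmul _ _ _ _ _ _).trans ?_
  change rightLeg (ofAlg (b ⊗ₜ[ℂ] c)) a = _
  rw [rightLeg_ofAlg, rightLegₗ_tmul]

/-- Cancelling `assoc` moves the coaction identity into `(A ⊗ C*(G)) ⊗ C*(G)`, where slices can act
on the outer leg. This one-sided inverse is all that is needed. -/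
theorem assocInv_assoc {C : Type w} [CStarAlgebra C] (z : MaxTensor (MaxTensor A B) C) :
    assocInv (assoc z) = z := by
  refine induction_tmul z (isClosed_eq (by fun_prop) (by fun_prop)) (by simp)
    (fun x y hx hy => by rw [map_add, map_add, hx, hy]) fun y c => ?_
  refine induction_tmul y (isClosed_eq (by fun_prop) (by fun_prop)) (by simp [zero_tmul])
    (fun x y hx hy => by rw [add_tmul, map_add, map_add, hx, hy]) fun a b => ?_
  rw [assoc_tmul, assocInv_tmul]

end AssocInv

/-- The *-homomorphism `A ⊗ C*(G) → (A ⊗ C*(G)) ⊗ C*(G)`, `a ⊗ s ↦ (a ⊗ s) ⊗ s`. -/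
def diagonal (G : Type v) [Group G] (A : Type u)
    [NonUnitalCStarAlgebra A] : MaxTensor A (GroupCStar G) →⋆ₙₐ[ℂ]
      MaxTensor (MaxTensor A (GroupCStar G)) (GroupCStar G) :=
  assocInv.comp (map (NonUnitalStarAlgHom.id ℂ A) (comult G))

theorem diagonal_tmul {G : Type v} [Group G] {A : Type u} [NonUnitalCStarAlgebra A]
    (a : A) (s : G) :
    diagonal G A (tmul a (groupU s)) =
      tmul (tmul a (groupU s)) (groupU s) := by
  change assocInv (map _ _ _) = _
  rw [map_tmul, comult_groupU, assocInv_tmul]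
  rfl

end MaxTensor

/-! ### Density of the spectral subspaces -/

namespace Coaction

variable {G : Type v} [Group G] {A : Type u} [NonUnitalCStarAlgebra A] (δ : Coaction G A)

theorem mem_spectralSubspace {s : G} {a : A} :
    a ∈ δ.spectralSubspace s ↔ δ.toHom a = MaxTensor.tmul a (groupU s) := Iff.rfl

/-- The coaction identity with the associator removed, the only form in which it is used below. -/
theorem map_toHom_toHom (a : A) :
    MaxTensor.map δ.toHom (NonUnitalStarAlgHom.id ℂ _) (δ.toHom a) =
      MaxTensor.diagonal G A (δ.toHom a) := by
  rw [← MaxTensor.assocInv_assoc (MaxTensor.map _ _ _), δ.coassoc a]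
  rfl

theorem map_toHom_tmul (a : A) (s : G) :
    MaxTensor.map δ.toHom (NonUnitalStarAlgHom.id ℂ _) (MaxTensor.tmul a (groupU s)) =
      MaxTensor.tmul (δ.toHom a) (groupU s) := MaxTensor.map_tmul _ _ _ _

/-- The trivial representation of `G` is a counit for every coaction. -/
theorem counit_toHom {ε : MaxTensor A (GroupCStar G) →⋆ₙₐ[ℂ] A}
    (hε : ∀ a s, ε (MaxTensor.tmul a (groupU s)) = a) (a : A) : ε (δ.toHom a) = a := by
  obtain ⟨ε', hε'⟩ := exists_counit_slice G (MaxTensor A (GroupCStar G))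
  -- With `ε'` the counit slice for `A ⊗ C*(G)`, one has `δ ∘ ε = ε' ∘ (δ ⊗ id)` and `ε' ∘ diagonal
  -- = id`. So `δ(ε(δ(a))) = δ(a)`, and `δ` is injective.
  have h1 := MaxTensor.ext_groupU (δ.toHom.comp ε)
    (ε'.comp (MaxTensor.map δ.toHom (NonUnitalStarAlgHom.id ℂ (GroupCStar G))))
    (by fun_prop) (by fun_prop) (fun a s => by
      rw [NonUnitalStarAlgHom.comp_apply, NonUnitalStarAlgHom.comp_apply, hε, map_toHom_tmul,
        hε']) (δ.toHom a)
  have h2 := MaxTensor.ext_groupU (ε'.comp (MaxTensor.diagonal G A)) (NonUnitalStarAlgHom.id ℂ _)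
    (by fun_prop) (by fun_prop) (fun a s => by
      rw [NonUnitalStarAlgHom.comp_apply, MaxTensor.diagonal_tmul, hε']
      rfl) (δ.toHom a)
  rw [NonUnitalStarAlgHom.comp_apply, NonUnitalStarAlgHom.comp_apply, map_toHom_toHom] at h1
  exact δ.injective (h1.trans h2)

/-- Slicing `δ(a)` at `s` gives an element of the spectral subspace at `s`. -/
theorem slice_toHom_mem [DecidableEq G] {s : G} {E : MaxTensor A (GroupCStar G) →L[ℂ] A}
    (hE : ∀ a t, E (MaxTensor.tmul a (groupU t)) = if t = s then a else 0) (a : A) :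
    E (δ.toHom a) ∈ δ.spectralSubspace s := by
  obtain ⟨E', hE'⟩ := exists_slice (MaxTensor A (GroupCStar G)) s
  -- With `E'` the slice at `s` for `A ⊗ C*(G)`, `δ ∘ E = E' ∘ (δ ⊗ id)`, while `E' ∘ diagonal` is
  -- `E` followed by `⊗ s`. The coaction identity equates the two on `δ(a)`.
  have h1 := MaxTensor.ext_groupU ((starHomL δ.toHom).comp E)
    (E'.comp (starHomL (MaxTensor.map δ.toHom (NonUnitalStarAlgHom.id ℂ (GroupCStar G)))))
    (by fun_prop) (by fun_prop) (fun a t => by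
      simp only [ContinuousLinearMap.comp_apply, starHomL_apply, hE, map_toHom_tmul, hE']
      split_ifs
      · rfl
      · exact map_zero _) (δ.toHom a)
  have h2 := MaxTensor.ext_groupU (E'.comp (starHomL (MaxTensor.diagonal G A)))
    ((MaxTensor.tmulL.flip (groupU s)).comp E)
    (by fun_prop) (by fun_prop) (fun a t => by
      simp only [ContinuousLinearMap.comp_apply, starHomL_apply, hE, MaxTensor.diagonal_tmul, hE',
        ContinuousLinearMap.flip_apply, MaxTensor.tmulL_apply]
      split_ifs with h
      · rw [h]
      · rw [MaxTensor.zero_tmul]) (δ.toHom a)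
  simp only [ContinuousLinearMap.comp_apply, starHomL_apply, map_toHom_toHom] at h1 h2
  exact h1.trans h2

/-- The spectral subspaces of a coaction of a discrete group span a dense subspace. -/
theorem dense_iSup_spectralSubspace :
    Dense ((⨆ s, δ.spectralSubspace s : Submodule ℂ A) : Set A) := by
  classical
  intro a
  change a ∈ ((⨆ s, δ.spectralSubspace s).topologicalClosure : Set A)
  set S := (⨆ s, δ.spectralSubspace s).topologicalClosure
  obtain ⟨Θ, hΘ⟩ := exists_diagonal_slice (G := G) A
  obtain ⟨ε, hε⟩ := exists_counit_slice G A
  -- `Θ ∘ diagonal = ε`; after the coaction identity and `ε ∘ δ = id`, this reads `Θ((δ ⊗ id)(δ(a)))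
  -- = a`.
  have h1 := MaxTensor.ext_groupU (Θ.comp (starHomL (MaxTensor.diagonal G A))) (starHomL ε)
    (by fun_prop) (by fun_prop) (fun a s => by
      simp [ContinuousLinearMap.comp_apply, starHomL_apply, hε, MaxTensor.diagonal_tmul, hΘ])
    (δ.toHom a)
  simp only [ContinuousLinearMap.comp_apply, starHomL_apply, ← map_toHom_toHom,
    δ.counit_toHom hε] at h1
  -- On `b ⊗ t` the value is `Θ(δ(b) ⊗ t)`, the slice of `δ(b)` at `t`, which is an element of
  -- `A_t`.
  have h2 : ∀ y, Θ (MaxTensor.map δ.toHom (NonUnitalStarAlgHom.id ℂ _) y) ∈ S := fun y => by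
    refine MaxTensor.induction_groupU y
      ((Submodule.isClosed_topologicalClosure _).preimage (by fun_prop)) (by simp) ?_ ?_
    · intro x y hx hy
      rw [map_add, map_add]
      exact S.add_mem hx hy
    · intro b t
      obtain ⟨E, hE⟩ := exists_slice A t
      have h3 := MaxTensor.ext_groupU (Θ.comp (MaxTensor.tmulL.flip (groupU t))) E
        (by fun_prop) (by fun_prop) (fun a s => by
          simp only [ContinuousLinearMap.comp_apply, ContinuousLinearMap.flip_apply,
            MaxTensor.tmulL_apply, hΘ, hE]) (δ.toHom b)
      simp only [ContinuousLinearMap.comp_apply, ContinuousLinearMap.flip_apply,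
        MaxTensor.tmulL_apply] at h3
      rw [map_toHom_tmul, h3]
      exact Submodule.le_topologicalClosure _
        (Submodule.mem_iSup_of_mem t (δ.slice_toHom_mem hE b))
  rw [SetLike.mem_coe, ← h1]
  exact h2 _

end Coaction

/-! ### Characteristic functions in `C₀(G)` -/

section Chi

variable {G : Type v} [TopologicalSpace G] [DiscreteTopology G]

theorem chi_apply [DecidableEq G] (s t : G) : chi s t = if t = s then 1 else 0 := by
  change Set.indicator {s} 1 t = _
  simp [Set.indicator_apply]

theorem chi_mul_self (s : G) : chi s * chi s = chi s := by
  classical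
  ext t
  simp [chi_apply]

theorem chi_mul_of_ne {s t : G} (h : s ≠ t) : chi s * chi t = 0 := by
  classical
  ext r
  simp only [ZeroAtInftyContinuousMap.mul_apply, chi_apply, ZeroAtInftyContinuousMap.zero_apply]
  by_cases hr : r = s
  · simp [hr, h]
  · simp [hr]

theorem star_chi (s : G) : star (chi s) = chi s := by
  classical
  ext t
  simp [chi_apply, apply_ite]

/-- A function vanishing at infinity on a discrete space is within `ε / 2` of its truncation to the
finite set where its modulus is at least `ε / 2`. -/
theorem dense_span_chi : Dense (Submodule.span ℂ (Set.range (chi (G := G))) : Set C₀(G, ℂ)) := by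
  classical
  intro f
  rw [Metric.mem_closure_iff]
  intro ε hε
  have hf : ∀ᶠ t in Filter.cofinite, ‖f t‖ < ε / 2 := by
    have h := f.zero_at_infty'
    rw [Filter.cocompact_eq_cofinite] at h
    simpa using h.norm.eventually_lt_const (by simpa using half_pos hε)
  set F : Finset G := hf.toFinset
  refine ⟨∑ s ∈ F, f s • chi s, Submodule.sum_mem _ fun s _ =>
    Submodule.smul_mem _ _ (Submodule.subset_span ⟨s, rfl⟩), ?_⟩
  rw [dist_eq_norm, ← ZeroAtInftyContinuousMap.norm_toBCF_eq_norm]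
  refine lt_of_le_of_lt ?_ (half_lt_self hε)
  rw [BoundedContinuousFunction.norm_le (half_pos hε).le]
  intro t
  have happ : (∑ s ∈ F, f s • chi s : C₀(G, ℂ)) t = if t ∈ F then f t else 0 := by
    have h1 : (∑ s ∈ F, f s • chi s : C₀(G, ℂ)) t = ∑ s ∈ F, (f s • chi s : C₀(G, ℂ)) t :=
      map_sum (⟨⟨fun g : C₀(G, ℂ) => g t, rfl⟩, fun _ _ => rfl⟩ : C₀(G, ℂ) →+ ℂ) _ F
    rw [h1]
    simp [chi_apply]
  change ‖f t - (∑ s ∈ F, f s • chi s : C₀(G, ℂ)) t‖ ≤ ε / 2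
  rw [happ]
  split_ifs with h
  · simpa using (half_pos hε).le
  · rw [sub_zero]
    by_contra hlt
    exact h (hf.mem_toFinset.mpr fun hlt₂ => hlt (le_of_lt hlt₂))

/-- The scalar representation of `C₀(G)` on `H` by evaluation at `t`. -/
def evalRep (H : Type w) [NormedAddCommGroup H] [InnerProductSpace ℂ H] [CompleteSpace H] (t : G) :
    C₀(G, ℂ) →⋆ₙₐ[ℂ] (H →L[ℂ] H) where
  toFun f := f t • 1
  map_smul' c f := by simp [mul_smul]
  map_zero' := by simp
  map_add' f g := by simp [add_smul]
  map_mul' f g := by simp [mul_smul, smul_comm (f t) (g t)]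
  map_star' f := by simp [star_smul]

theorem isNondegenerate_evalRep (H : Type w) [NormedAddCommGroup H] [InnerProductSpace ℂ H]
    [CompleteSpace H] (t : G) : IsNondegenerate (evalRep H t) := by
  classical
  have h : Submodule.span ℂ {h : H | ∃ b k, h = evalRep H t b k} = ⊤ := by
    refine eq_top_iff.mpr fun k _ => Submodule.subset_span ⟨chi t, k, ?_⟩
    change k = (chi t t • (1 : H →L[ℂ] H)) k
    simp [chi_apply]
  rw [IsNondegenerate, h]
  exact dense_univ

end Chi

/-! ### The regular covariant representation -/

namespace Coaction

variable {G : Type v} [Group G] {A : Type u} [NonUnitalCStarAlgebra A] (δ : Coaction G A)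

theorem mul_mem_spectralSubspace {s t : G} {a b : A} (ha : a ∈ δ.spectralSubspace s)
    (hb : b ∈ δ.spectralSubspace t) : a * b ∈ δ.spectralSubspace (s * t) := by
  rw [mem_spectralSubspace] at *
  rw [map_mul, ha, hb, MaxTensor.tmul_mul, groupU_mul]

theorem star_mem_spectralSubspace {s : G} {a : A} (ha : a ∈ δ.spectralSubspace s) :
    star a ∈ δ.spectralSubspace s⁻¹ := by
  rw [mem_spectralSubspace] at *
  rw [map_star, ha, MaxTensor.star_tmul, groupU_inv]

theorem isClosed_spectralSubspace (s : G) : IsClosed (δ.spectralSubspace s : Set A) := by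
  change IsClosed {a | δ.toHom a = MaxTensor.tmul a (groupU s)}
  exact isClosed_eq (by fun_prop) (by fun_prop)

/-- For `a ∈ A_s` the vector `e_t ⊗ π(a)h` is the image of `e_{s⁻¹t} ⊗ h`. Density of the spectral
subspaces extends this to the closure for every `a`, and nondegeneracy of `π` then gives every `e_t
⊗ k`. -/
theorem isNondegenerate_regularRep {H : Type w} [NormedAddCommGroup H] [InnerProductSpace ℂ H]
    [CompleteSpace H] {π : A →⋆ₙₐ[ℂ] (H →L[ℂ] H)} (hπ : IsNondegenerate π) :
    IsNondegenerate ((regularRep π).comp δ.toHom) := by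
  classical
  refine dense_of_single_mem _ fun t k => ?_
  set S := Submodule.span ℂ
    {h : lp (fun _ : G => H) 2 | ∃ b k, h = (regularRep π).comp δ.toHom b k}
  let T : Submodule ℂ H :=
    S.topologicalClosure.comap (lp.lsingle (𝕜 := ℂ) (E := fun _ : G => H) 2 t)
  have hT : IsClosed (T : Set H) := S.isClosed_topologicalClosure.preimage
    (lp.isometry_single (E := fun _ : G => H) (p := 2) t).continuous
  have key : ∀ (a : A) (h : H), π a h ∈ T := fun a h => by
    let ev : A →L[ℂ] H := (ContinuousLinearMap.apply ℂ H h).comp (starHomL π)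
    have hcl : IsClosed (T.comap ev.toLinearMap : Set A) := hT.preimage ev.continuous
    refine hcl.closure_subset_iff.mpr ?_ (δ.dense_iSup_spectralSubspace a)
    rw [SetLike.coe_subset_coe, iSup_le_iff]
    intro s a ha
    change lp.single 2 t (π a h) ∈ S.topologicalClosure
    refine S.le_topologicalClosure (Submodule.subset_span
      ⟨a, lp.single (E := fun _ : G => H) 2 (s⁻¹ * t) h, ?_⟩)
    rw [NonUnitalStarAlgHom.comp_apply, δ.mem_spectralSubspace.mp ha, regularRep_tmul_single,
      mul_inv_cancel_left]
  refine hT.closure_subset_iff.mpr ?_ (hπ k)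
  refine Submodule.span_le.mpr ?_
  rintro _ ⟨a, h, rfl⟩
  exact key a h

variable [TopologicalSpace G] [DiscreteTopology G]

/-- The covariant representation `((π ⊗ λ) ∘ δ, 1 ⊗ M)` on `ℓ²(G, H)`. -/
def regularCovariantRep {H : Type u} [NormedAddCommGroup H] [InnerProductSpace ℂ H]
    [CompleteSpace H] (π : A →⋆ₙₐ[ℂ] (H →L[ℂ] H)) (hπ : IsNondegenerate π) : CovariantRep δ where
  H := lp (fun _ : G => H) 2
  π := (regularRep π).comp δ.toHom
  μ := directSumRep fun t => evalRep H t
  nondegenerate_π := δ.isNondegenerate_regularRep hπ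
  nondegenerate_μ := isNondegenerate_directSumRep _ fun t => isNondegenerate_evalRep H t
  covariant s t a ha := by
    classical
    rw [NonUnitalStarAlgHom.comp_apply, δ.mem_spectralSubspace.mp ha, regularRep_tmul]
    ext ξ i
    -- At coordinate `i` both sides are `π(a) ξ(s⁻¹i)` cut off by an indicator, and `s⁻¹i = t`
    -- exactly when `i = st`.
    change π a ((chi t (s⁻¹ * i) • (1 : H →L[ℂ] H)) (ξ (s⁻¹ * i))) =
      (chi (s * t) i • (1 : H →L[ℂ] H)) (π a (ξ (s⁻¹ * i)))
    simp only [chi_apply, inv_mul_eq_iff_eq_mul]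
    split_ifs <;> simp

/-! ### The corner of the crossed product -/

theorem jA_mul_jG_chi {s : G} {a : A} (ha : a ∈ δ.spectralSubspace s) (t : G) :
    δ.jA a * δ.jG (chi t) = δ.jG (chi (s * t)) * δ.jA a :=
  Subtype.ext <| funext fun ρ => ρ.covariant s t a ha

theorem jG_chi_mul_jA {s : G} {a : A} (ha : a ∈ δ.spectralSubspace s) (t : G) :
    δ.jG (chi t) * δ.jA a = δ.jA a * δ.jG (chi (s⁻¹ * t)) := by
  rw [δ.jA_mul_jG_chi ha, mul_inv_cancel_left]

theorem jG_chi_mul_jG_chi [DecidableEq G] (s t : G) :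
    δ.jG (chi s) * δ.jG (chi t) = if s = t then δ.jG (chi s) else 0 := by
  rw [← map_mul]
  split_ifs with h
  · rw [h, chi_mul_self]
  · rw [chi_mul_of_ne h, map_zero]

/-- The span of the products `j_A(a) j_G(χ_t)` with `a` in a spectral subspace. -/
def spectralSpan : Submodule ℂ δ.Ambient :=
  Submodule.span ℂ {x | ∃ s t, ∃ a ∈ δ.spectralSubspace s, x = δ.jA a * δ.jG (chi t)}

/-- `spectralSpan` as a *-subalgebra. -/
def spectralSubalgebra : NonUnitalStarSubalgebra ℂ δ.Ambient where
  __ := δ.spectralSpan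
  mul_mem' {x y} hx hy := by
    classical
    change x * y ∈ δ.spectralSpan
    induction hx using Submodule.span_induction with
    | zero =>
      rw [zero_mul]
      exact Submodule.zero_mem _
    | add x x' _ _ hx hx' =>
      rw [add_mul]
      exact Submodule.add_mem _ hx hx'
    | smul c x _ hx =>
      rw [smul_mul_assoc]
      exact Submodule.smul_mem _ c hx
    | mem x hx =>
      obtain ⟨s, t, a, ha, rfl⟩ := hx
      induction hy using Submodule.span_induction with
      | zero =>
        rw [mul_zero]
        exact Submodule.zero_mem _
      | add y y' _ _ hy hy' =>
        rw [mul_add]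
        exact Submodule.add_mem _ hy hy'
      | smul c y _ hy =>
        rw [mul_smul_comm]
        exact Submodule.smul_mem _ c hy
      | mem y hy =>
        obtain ⟨r, q, b, hb, rfl⟩ := hy
        -- Moving `χ_t` past `b ∈ A_r` turns it into `χ_{r⁻¹t}`, which either equals `χ_q` or is
        -- orthogonal to it.
        rw [mul_assoc, ← mul_assoc (δ.jG (chi t)), δ.jG_chi_mul_jA hb, mul_assoc,
          jG_chi_mul_jG_chi]
        split_ifs
        · rw [← mul_assoc, ← map_mul]
          exact Submodule.subset_span ⟨_, _, _, δ.mul_mem_spectralSubspace ha hb, rfl⟩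
        · rw [mul_zero, mul_zero]
          exact Submodule.zero_mem _
  star_mem' {x} hx := by
    change star x ∈ δ.spectralSpan
    induction hx using Submodule.span_induction with
    | zero =>
      rw [star_zero]
      exact Submodule.zero_mem _
    | add x x' _ _ hx hx' =>
      rw [star_add]
      exact Submodule.add_mem _ hx hx'
    | smul c x _ hx =>
      rw [star_smul]
      exact Submodule.smul_mem _ _ hx
    | mem x hx =>
      obtain ⟨s, t, a, ha, rfl⟩ := hx
      have ha' := δ.star_mem_spectralSubspace ha
      rw [star_mul, ← map_star, ← map_star, star_chi, δ.jG_chi_mul_jA ha']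
      exact Submodule.subset_span ⟨_, _, _, ha', rfl⟩

/-- The product is continuous in each variable, so `f` may be taken to be some `χ_t` and `a` to lie
in some `A_s`, by the two density theorems. -/
theorem jA_mul_jG_mem (a : A) (f : C₀(G, ℂ)) :
    δ.jA a * δ.jG f ∈ δ.spectralSpan.topologicalClosure := by
  have hS := δ.spectralSpan.isClosed_topologicalClosure
  let L : A →L[ℂ] C₀(G, ℂ) →L[ℂ] δ.Ambient :=
    (ContinuousLinearMap.mul ℂ δ.Ambient).bilinearComp (starHomL δ.jA) (starHomL δ.jG)
  have hf : IsClosed (δ.spectralSpan.topologicalClosure.comap (L a).toLinearMap :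
      Set C₀(G, ℂ)) := hS.preimage (L a).continuous
  refine hf.closure_subset_iff.mpr ?_ (dense_span_chi f)
  refine Submodule.span_le.mpr ?_
  rintro _ ⟨t, rfl⟩
  have ha : IsClosed (δ.spectralSpan.topologicalClosure.comap (L.flip (chi t)).toLinearMap :
      Set A) := hS.preimage (L.flip (chi t)).continuous
  refine ha.closure_subset_iff.mpr ?_ (δ.dense_iSup_spectralSubspace a)
  rw [SetLike.coe_subset_coe, iSup_le_iff]
  intro s a ha
  exact δ.spectralSpan.le_topologicalClosure (Submodule.subset_span ⟨s, t, a, ha, rfl⟩)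

theorem crossedProduct_le : δ.crossedProduct ≤ δ.spectralSubalgebra.topologicalClosure := by
  refine NonUnitalStarSubalgebra.topologicalClosure_minimal _ ?_
    (NonUnitalStarSubalgebra.isClosed_topologicalClosure _)
  refine NonUnitalStarAlgebra.adjoin_le ?_
  rintro _ ⟨a, f, rfl⟩
  exact δ.jA_mul_jG_mem a f

/-- The *-homomorphism `a ↦ j_A(a) j_G(χ_1)` on the fixed point algebra. -/
def cornerHom : δ.fixedPointAlgebra →⋆ₙₐ[ℂ] δ.Ambient where
  toFun a := δ.jA a * δ.jG (chi 1)
  map_smul' c a := by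
    rw [NonUnitalStarSubalgebra.coe_smul, map_smul, smul_mul_assoc]
    rfl
  map_zero' := by
    rw [NonUnitalStarSubalgebra.coe_zero, map_zero, zero_mul]
  map_add' a b := by
    rw [NonUnitalStarSubalgebra.coe_add, map_add, add_mul]
  map_mul' a b := by
    classical
    have hb : (b : A) ∈ δ.spectralSubspace 1 := b.2
    rw [NonUnitalStarSubalgebra.coe_mul, map_mul, mul_assoc, mul_assoc,
      ← mul_assoc (δ.jG (chi 1)), δ.jG_chi_mul_jA hb, mul_assoc, inv_one, one_mul,
      jG_chi_mul_jG_chi, if_pos rfl]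
  map_star' a := by
    have ha : star (a : A) ∈ δ.spectralSubspace 1 := (star a).2
    rw [star_mul, ← map_star, ← map_star, star_chi, δ.jG_chi_mul_jA ha, inv_one, one_mul]
    rfl

theorem cornerHom_apply (a : δ.fixedPointAlgebra) :
    δ.cornerHom a = δ.jA a * δ.jG (chi 1) := rfl

/-- In the regular covariant representation of a faithful `π`, `χ_1` fixes `e_1 ⊗ h` and `a ∈ A_1`
sends it to `e_1 ⊗ π(a)h`. Vanishing therefore forces `π(a) = 0`. -/
theorem injective_cornerHom : Function.Injective δ.cornerHom := by
  classical
  rw [injective_iff_map_eq_zero]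
  intro a ha
  obtain ⟨H, _, _, _, π, hπ, hnd⟩ := exists_faithful_rep A
  have ha1 : (a : A) ∈ δ.spectralSubspace 1 := a.2
  have h1 : (δ.regularCovariantRep π hnd).π a * (δ.regularCovariantRep π hnd).μ (chi 1) = 0 :=
    congrFun (congrArg Subtype.val ha) (δ.regularCovariantRep π hnd)
  refine Subtype.ext (hπ ?_)
  rw [NonUnitalStarSubalgebra.coe_zero, map_zero]
  ext h
  have h2 : regularRep π (δ.toHom a) (directSumRep (fun t => evalRep H t) (chi (1 : G))
      (lp.single (E := fun _ : G => H) 2 1 h)) = 0 :=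
    DFunLike.congr_fun h1 (lp.single (E := fun _ : G => H) 2 1 h)
  have h3 : evalRep H (1 : G) (chi 1) h = h := by
    change (chi (1 : G) 1 • (1 : H →L[ℂ] H)) h = h
    simp [chi_apply]
  rw [directSumRep_single, h3, δ.mem_spectralSubspace.mp ha1, regularRep_tmul_single] at h2
  have h4 := congrArg (fun ξ : lp (fun _ : G => H) 2 => ξ 1) h2
  simpa using h4

theorem isClosed_range_cornerHom : IsClosed (Set.range δ.cornerHom) := by
  -- Closedness makes the fixed point algebra a C*-algebra, so the injective `cornerHom` is
  -- isometric with closed range.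
  have hcl : IsClosed (δ.fixedPointAlgebra : Set A) := δ.isClosed_spectralSubspace 1
  exact isClosed_range_of_injective δ.injective_cornerHom

theorem cornerHom_mem_crossedProduct (a : δ.fixedPointAlgebra) :
    δ.cornerHom a ∈ δ.crossedProduct :=
  NonUnitalStarSubalgebra.le_topologicalClosure _
    (NonUnitalStarAlgebra.subset_adjoin ℂ _ ⟨a, chi 1, rfl⟩)

theorem corner_cornerHom (a : δ.fixedPointAlgebra) :
    δ.jG (chi 1) * δ.cornerHom a * δ.jG (chi 1) = δ.cornerHom a := by
  classical
  have ha : (a : A) ∈ δ.spectralSubspace 1 := a.2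
  rw [cornerHom_apply, ← mul_assoc, δ.jG_chi_mul_jA ha, inv_one, one_mul, mul_assoc, mul_assoc,
    jG_chi_mul_jG_chi, if_pos rfl, jG_chi_mul_jG_chi, if_pos rfl]

/-- For `a ∈ A_s`, moving the left `χ_1` past `a` leaves `χ_{s⁻¹} χ_t χ_1` on the right, which is
nonzero only for `s = t = 1`. -/
theorem corner_mem_range_of_mem_spectralSpan {x : δ.Ambient} (hx : x ∈ δ.spectralSpan) :
    δ.jG (chi 1) * x * δ.jG (chi 1) ∈ Set.range δ.cornerHom := by
  classical
  induction hx using Submodule.span_induction with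
  | zero => exact ⟨0, by simp⟩
  | add x y _ _ hx hy =>
    obtain ⟨a, ha⟩ := hx
    obtain ⟨b, hb⟩ := hy
    exact ⟨a + b, by rw [map_add, ha, hb, mul_add, add_mul]⟩
  | smul c x _ hx =>
    obtain ⟨a, ha⟩ := hx
    exact ⟨c • a, by rw [map_smul, ha, mul_smul_comm, smul_mul_assoc]⟩
  | mem x hx =>
    obtain ⟨s, t, a, ha, rfl⟩ := hx
    rw [← mul_assoc, δ.jG_chi_mul_jA ha, mul_one, mul_assoc, mul_assoc, jG_chi_mul_jG_chi]
    split_ifs with ht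
    · rw [ht, jG_chi_mul_jG_chi]
      split_ifs with hs
      · rw [inv_eq_one] at hs
        subst hs
        exact ⟨⟨a, ha⟩, by rw [cornerHom_apply, inv_one]⟩
      · exact ⟨0, by simp⟩
    · exact ⟨0, by simp⟩

/-- Compression by `χ_1` is continuous and the range is closed, so the computation on the span
passes to its closure. -/
theorem corner_mem_range {x : δ.Ambient} (hx : x ∈ δ.crossedProduct) :
    δ.jG (chi 1) * x * δ.jG (chi 1) ∈ Set.range δ.cornerHom := by
  have hcont : Continuous fun x : δ.Ambient => δ.jG (chi 1) * x * δ.jG (chi 1) := by fun_prop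
  exact (δ.isClosed_range_cornerHom.preimage hcont).closure_subset_iff.mpr
    (fun y hy => δ.corner_mem_range_of_mem_spectralSpan hy) (δ.crossedProduct_le hx)

end Coaction

end DiscreteCoaction

end

/-! ### The fixed point algebra as a corner -/

theorem lemma4p6 {G : Type*} [Group G] [TopologicalSpace G] [DiscreteTopology G]
    {A : Type*} [NonUnitalCStarAlgebra A] (δ : DiscreteCoaction.Coaction G A) :
    ∃ C : NonUnitalStarSubalgebra ℂ δ.Ambient,
      (C : Set δ.Ambient) = {y | ∃ x ∈ δ.crossedProduct,
        y = δ.jG (DiscreteCoaction.chi 1) * x * δ.jG (DiscreteCoaction.chi 1)} ∧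
      C ≤ δ.crossedProduct ∧
      Nonempty (δ.fixedPointAlgebra ≃⋆ₐ[ℂ] C) := by
  -- Taking the range of `cornerHom` as the witness makes the *-subalgebra property of the corner
  -- automatic once the two sets agree.
  refine ⟨NonUnitalStarAlgHom.range δ.cornerHom, ?_, ?_,
    ⟨StarAlgEquiv.ofInjective' δ.cornerHom δ.injective_cornerHom⟩⟩
  · ext y
    constructor
    · rintro ⟨a, rfl⟩
      exact ⟨_, δ.cornerHom_mem_crossedProduct a, (δ.corner_cornerHom a).symm⟩
    · rintro ⟨x, hx, rfl⟩
      exact δ.corner_mem_range hx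
  · rintro _ ⟨a, rfl⟩
    exact δ.cornerHom_mem_crossedProduct a
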